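/- **Theorem 8.1.** Let $k,r$ be positive integers with $r\ge k$. *Definitions.* A $k$-graph $G$ is a finite vertex set $V(G)$ with a set $E(G)$ of $k$-element subsets of $V(G)$. A homomorphism $F\to G$ of $k$-graphs is a map $V(F)\to V(G)$ sending every edge of $F$ onto an edge of $G$. For a (possibly infinite) family $\mathcal F$ of $k$-graphs, $G$ is $\mathcal F$-hom-free if no $F\in\mathcal F$ has a homomorphism to $G$, and $\mathcal F$-free if no $F\in\mathcal F$ has an injective homomorphism to $G$. Let $\mathrm{ex}(n,\mathcal F)$ be the maximum number of edges of an $\mathcal F$-free $k$-graph on $n$ vertices (read as $0$ if there is no such $k$-graph), and let $\pi(\mathcal F)=\lim_{n\to\infty}\mathrm{ex}(n,\mathcal F)/\binom nk$. The blowup density of $G$ is $$b(G)=k!\,\max\Big\{\sum_{e\in E(G)}\prod_{v\in e}x_v \;:\; x_v\ge 0\ (v\in V(G)),\ \sum_{v\in V(G)}x_v=1\Big\},$$ and $K_r^{(k)}$ is the complete $k$-graph on $r$ vertices. A partial $k$-graph is a simplicial complex all of whose faces have at most $k$ vertices. Its extension is the $k$-graph obtained by adding, to each maximal face $e$, $k-|e|$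 new vertices so as to get a $k$-edge, where different maximal faces receive disjoint sets of new vertices (the edges of the extension are exactly these sets). For integers $1\le i\le k-1$ and $N$, and integers $1=t_0<t_1<\dots<t_i<t_{i+1}=N+1$, let $F^{(\vec t)}$ be the partial $k$-graph on the vertex set $\{v_1,\dots,v_{k-i-1},w_1,\dots,w_N\}$ spanned by the faces $$\{v_1,\dots,v_{k-i-1}\}\cup\{w_m,w_{t_{j+1}},\dots,w_{t_i}\}\qquad(0\le j\le i,\ t_j\le m<t_{j+1}).$$ *Statement.* Let $\mathcal F$ be a family of $k$-graphs such that for every $i\in\{1,\dots,k-1\}$, every $N$, and every set $T$ of exactly $\binom{r-k+i}{i}+1$ distinct vectors $\vec t$ as above (for these $i$ and $N$), the extension of the union $\bigcup_{\vec t\in T}F^{(\vec t)}$ is not $\mathcal F$-hom-free. Then the limit defining $\pi(\mathcal F)$ exists, and $$\pi(\mathcal F)\le b\big(K_r^{(k)}\big).$$ -/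

import Mathlib

open Filter Topology

universe u

/-! ### `k`-graphs, homomorphisms, Turán density, blowup density -/

/-- A `k`-uniform hypergraph on the vertex set `V`: a set of `k`-element subsets of `V`. -/
structure KGraph (k : ℕ) (V : Type*) where
  /-- the edges -/
  edges : Finset (Finset V)
  /-- every edge has exactly `k` vertices -/
  card_eq : ∀ e ∈ edges, e.card = k

/-- A finite `k`-graph bundled with its vertex set, so that families of `k`-graphs can be formed. -/
structure FinKGraph (k : ℕ) : Type (u + 1) where
  /-- the vertex set -/
  V : Type u
  /-- the vertex set is finite -/
  finite : Finite V
  /-- the `k`-graph on this vertex set -/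
  graph : KGraph k V

namespace KGraph

variable {k : ℕ}

/-- `f` is a homomorphism `F → G`: it sends each edge of `F` onto an edge of `G`. (It is then
injective on each edge, since both edges have `k` vertices.) -/
def IsHom {U V : Type*} (F : KGraph k U) (G : KGraph k V) (f : U → V) : Prop :=
  ∀ e ∈ F.edges, ∃ e' ∈ G.edges, (e' : Set V) = f '' (e : Set U)

/-- `G` is `𝓕`-hom-free: no member of `𝓕` has a homomorphism to `G`. -/
def IsHomFree {V : Type*} (𝓕 : Set (FinKGraph.{u} k)) (G : KGraph k V) : Prop :=
  ∀ F ∈ 𝓕, ¬ ∃ f : F.V → V, IsHom F.graph G f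

/-- `G` is `𝓕`-free: `G` has no (not necessarily induced) subgraph isomorphic to a member
of `𝓕`. -/
def IsFree {V : Type*} (𝓕 : Set (FinKGraph.{u} k)) (G : KGraph k V) : Prop :=
  ∀ F ∈ 𝓕, ¬ ∃ f : F.V → V, Function.Injective f ∧ IsHom F.graph G f

/-- The Turán number `ex(n, 𝓕)`: the maximum number of edges of an `𝓕`-free `k`-graph on
`n` vertices. -/
noncomputable def ex (n : ℕ) (𝓕 : Set (FinKGraph.{u} k)) : ℕ :=
  sSup {m : ℕ | ∃ G : KGraph k (Fin n), G.IsFree 𝓕 ∧ G.edges.card = m}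

/-- The ratio `ex(n, 𝓕) / (n choose k)`. -/
noncomputable def turanRatio (𝓕 : Set (FinKGraph.{u} k)) (n : ℕ) : ℝ :=
  (ex n 𝓕 : ℝ) / (n.choose k : ℝ)

/-- The Turán density `π(𝓕) = lim_{n → ∞} ex(n, 𝓕) / (n choose k)`. -/
noncomputable def turanDensity (𝓕 : Set (FinKGraph.{u} k)) : ℝ :=
  limUnder atTop (turanRatio 𝓕)

/-- The hypergraph Lagrangian `L(G)`: the maximum of `∑_{e ∈ E(G)} ∏_{v ∈ e} x_v` over all
nonnegative weights `x` on the vertices with total weight `1`. -/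
noncomputable def lagrangian {V : Type*} [Fintype V] (G : KGraph k V) : ℝ :=
  sSup ((fun x : V → ℝ => ∑ e ∈ G.edges, ∏ v ∈ e, x v) '' stdSimplex ℝ V)

/-- The blowup density `b(G) = k! L(G)`. -/
noncomputable def blowupDensity {V : Type*} [Fintype V] (G : KGraph k V) : ℝ :=
  (k.factorial : ℝ) * G.lagrangian

/-- The complete `k`-graph `K_r^{(k)}` on `r` vertices. -/
def complete (k r : ℕ) : KGraph k (Fin r) where
  edges := Finset.powersetCard k Finset.univ
  card_eq _ he := (Finset.mem_powersetCard.mp he).2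

end KGraph

/-! ### Partial `k`-graphs and their extensions -/

/-- A partial `k`-graph: a simplicial complex whose faces ("partial edges") have at most `k`
vertices. -/
structure PartialKGraph (k : ℕ) (V : Type*) extends PreAbstractSimplicialComplex V where
  /-- every face has at most `k` vertices -/
  card_le : ∀ e ∈ faces, e.card ≤ k

namespace PartialKGraph

variable {k : ℕ} {V : Type*}

/-- The partial `k`-graph spanned (generated) by a set of finite vertex sets of size at most `k`:
its faces are the nonempty subsets of the generators. -/
def span (S : Set (Finset V)) (hS : ∀ s ∈ S, s.card ≤ k) : PartialKGraph k V where
  faces := {e | e.Nonempty ∧ ∃ s ∈ S, e ⊆ s}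
  isRelLowerSet_faces := fun _ ⟨hne, s, hs, hes⟩ =>
    ⟨hne, fun _ hte htne => ⟨htne, s, hs, hte.trans hes⟩⟩
  card_le := fun _ ⟨_, s, hs, hes⟩ => (Finset.card_le_card hes).trans (hS s hs)

/-- The union of the partial `k`-graphs `P t`, `t ∈ T`, all on the same vertex set. -/
def union {ι : Type*} (T : Finset ι) (P : ι → PartialKGraph k V) : PartialKGraph k V where
  faces := {e | ∃ t ∈ T, e ∈ (P t).faces}
  isRelLowerSet_faces := fun _ ⟨t, ht, he⟩ =>
    ⟨((P t).isRelLowerSet_faces he).1,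
      fun _ hse hs => ⟨t, ht, ((P t).isRelLowerSet_faces he).2 hse hs⟩⟩
  card_le := fun e ⟨t, _, he⟩ => (P t).card_le e he

/-- The maximal partial edges of `P`. -/
abbrev MaxFace (P : PartialKGraph k V) : Type _ :=
  {e : Finset V // Maximal (· ∈ P.faces) e}

/-- The vertex set of the extension of `P`: the vertices of `P`, together with `k - |e|` new
vertices for each maximal partial edge `e`. -/
abbrev ExtVertex (P : PartialKGraph k V) : Type _ :=
  V ⊕ (Σ e : P.MaxFace, Fin (k - e.1.card))

/-- The edge of the extension coming from the maximal partial edge `e`: `e` together with all the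
new vertices that belong to `e`. -/
def extEdge (P : PartialKGraph k V) (e : P.MaxFace) : Finset P.ExtVertex :=
  e.1.disjSum ((Finset.univ : Finset (Fin (k - e.1.card))).map (Function.Embedding.sigmaMk e))

/-- The extension of a partial `k`-graph `P` on a finite vertex set: each maximal partial edge is
completed to a `k`-edge by new vertices, different edges sharing no new vertex. -/
noncomputable def extension [Finite V] (P : PartialKGraph k V) : KGraph k P.ExtVertex where
  edges := (Set.toFinite (Set.range P.extEdge)).toFinset
  card_eq := by
    intro e' he'
    obtain ⟨e, rfl⟩ := (Set.Finite.mem_toFinset _).mp he'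
    have h := P.card_le e.1 e.2.1
    simp only [extEdge, Finset.card_disjSum, Finset.card_map, Finset.card_univ, Fintype.card_fin]
    omega

end PartialKGraph

/-! ### The partial forests `F^{(t)}` -/

/-- The vectors `t` with `1 = t_0 < t_1 < ⋯ < t_i < t_{i+1} = N + 1`. -/
structure ForestIndex (i N : ℕ) where
  /-- the entries `t_0, …, t_{i+1}` -/
  t : Fin (i + 2) → ℕ
  /-- the entries increase strictly -/
  strictMono : StrictMono t
  /-- `t_0 = 1` -/
  t_zero : t 0 = 1
  /-- `t_{i+1} = N + 1` -/
  t_last : t (Fin.last (i + 1)) = N + 1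

/-- The common vertex set `{v_1, …, v_{k-i-1}, w_1, …, w_N}` of the partial forests. The vertices
`v` are the left summand, and `w_m` is the element `m` of the right summand. -/
abbrev ForestVertex (k i N : ℕ) : Type :=
  Fin (k - i - 1) ⊕ Finset.Icc 1 N

namespace ForestIndex

variable {i N : ℕ}

/-- The set `{v_1, …, v_{k-i-1}} ∪ {w_m, w_{t_{j+1}}, …, w_{t_i}}`. -/
def spanningEdge (k : ℕ) (τ : ForestIndex i N) (j : Fin (i + 1)) (m : Finset.Icc 1 N) :
    Finset (ForestVertex k i N) :=
  (Finset.univ : Finset (Fin (k - i - 1))).disjSum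
    ({m} ∪ Finset.univ.filter fun p : Finset.Icc 1 N =>
      ∃ l : Fin (i + 2), j.castSucc < l ∧ l < Fin.last (i + 1) ∧ τ.t l = p)

theorem card_spanningEdge_le {k : ℕ} (hi : i < k) (τ : ForestIndex i N) (j : Fin (i + 1))
    (m : Finset.Icc 1 N) : (τ.spanningEdge k j m).card ≤ k := by
  have h1 : (Finset.univ.filter fun p : Finset.Icc 1 N =>
      ∃ l : Fin (i + 2), j.castSucc < l ∧ l < Fin.last (i + 1) ∧ τ.t l = p).card
      ≤ (Finset.Ioo j.castSucc (Fin.last (i + 1))).card := by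
    rw [← Finset.card_map (Function.Embedding.subtype _)]
    refine (Finset.card_le_card (t := (Finset.Ioo j.castSucc (Fin.last (i + 1))).image τ.t)
      ?_).trans Finset.card_image_le
    intro p hp
    simp only [Finset.mem_map, Finset.mem_filter, Finset.mem_univ, true_and] at hp
    obtain ⟨q, ⟨l, h1, h2, h3⟩, rfl⟩ := hp
    exact Finset.mem_image.mpr ⟨l, Finset.mem_Ioo.mpr ⟨h1, h2⟩, h3⟩
  rw [Fin.card_Ioo] at h1
  have h2 := Finset.card_union_le {m} (Finset.univ.filter fun p : Finset.Icc 1 N =>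
      ∃ l : Fin (i + 2), j.castSucc < l ∧ l < Fin.last (i + 1) ∧ τ.t l = p)
  simp only [Finset.card_singleton, Fin.val_last, Fin.val_castSucc] at h1 h2
  simp only [spanningEdge, Finset.card_disjSum, Finset.card_univ, Fintype.card_fin]
  omega

/-- The partial forest `F^{(t)}`: the partial `k`-graph spanned by the partial edges
`{v_1, …, v_{k-i-1}} ∪ {w_m, w_{t_{j+1}}, …, w_{t_i}}` for `0 ≤ j ≤ i` and
`t_j ≤ m < t_{j+1}`. -/
def forest {k : ℕ} (hi : i < k) (τ : ForestIndex i N) :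
    PartialKGraph k (ForestVertex k i N) :=
  PartialKGraph.span
    {s | ∃ (j : Fin (i + 1)) (m : Finset.Icc 1 N),
      τ.t j.castSucc ≤ m ∧ (m : ℕ) < τ.t j.succ ∧ s = τ.spanningEdge k j m}
    (by
      rintro s ⟨j, m, -, -, rfl⟩
      exact card_spanningEdge_le hi τ j m)

end ForestIndex

/-! ### Exchangeable laws on lists and their entropies -/

/-! Entropy method. Let `G` be `𝓕`-hom-free, let X_1, …, X_k be a uniformly random ordered edge, and
put h_n = H(X_{n+1} | X_1, …, X_n). The h_n sum to log(k!|E|) and h_0 ≤ log|V|, so an upper bound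
for ∑ (h_n - h_0) bounds the density.

Fix i. Draw v_1, …, v_{k-i-1} as the start of a random edge and, given these, draw w_1, …, w_N
independently, each distributed as the next vertex. Call a vector t good if every generating face of
F^(t) is sent injectively into an edge. More than C(r-k+i, i) good vectors at once would give a
homomorphism to `G` from an extension that is not hom-free; hence the probabilities of being good
sum to at most C(r-k+i, i). On the other hand, a change of measure and Jensen's inequality
(`chainBound_le`) bound the probability for t below by ∏_{j<i} y_j^(t_{j+1}-t_j), where y_j =
exp(h_{k-1-j} - h_{k-1-i}). Summing the geometric series over all gaps (`prod_exp_le`,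
`prod_div_one_sub_le`) gives, with x_j = exp h_{k-1-j}, ∏_{j<i} x_j/(x_i - x_j) ≤ C(r-k+i, i) for
every i < k. All of these are equalities at x_j = r-k+j+1, and that point maximises ∏_j x_j/x_{k-1}
(`sum_sub_le_of_prod_le_choose`). So k!|E| ≤ |V|^k · r(r-1)⋯(r-k+1)/r^k, and the last factor is a
lower bound for the blowup density of the complete graph, from uniform weights.

Sampling and supersaturation (`exists_isHomFree`) supply hom-free graphs of density close to π(𝓕),
which transfers the bound to π(𝓕). -/

/-- `p u` is the probability that a random exchangeable `k`-tuple starts with `u`. -/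
structure IsExchangeable {V : Type*} [Fintype V] (k : ℕ) (p : List V → ℝ) : Prop where
  nonneg : ∀ u, 0 ≤ p u
  perm : ∀ u v : List V, u.Perm v → p u = p v
  sum_cons : ∀ u : List V, u.length < k → ∑ x, p (x :: u) = p u
  nil : p [] = 1

theorem sum_ofFn_succ {V : Type*} [Fintype V] (n : ℕ) (f : List V → ℝ) :
    ∑ u : Fin (n + 1) → V, f (List.ofFn u) = ∑ u : Fin n → V, ∑ x, f (x :: List.ofFn u) := by
  rw [← (Fin.consEquiv fun _ => V).sum_comp, Fintype.sum_prod_type, Finset.sum_comm]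
  simp [Fin.consEquiv]

/-- Jensen's inequality for the logarithm. Positivity of `z` is asked only where the weight is
positive, since in the applications the other terms may vanish. -/
theorem sum_mul_log_le_log {ι : Type*} (s : Finset ι) (w z : ι → ℝ) (c : ℝ) (hc : 0 < c)
    (hw : ∀ i ∈ s, 0 ≤ w i) (hw1 : ∑ i ∈ s, w i = 1) (hz : ∀ i ∈ s, 0 < w i → 0 < z i)
    (h : ∑ i ∈ s, w i * z i ≤ c) : ∑ i ∈ s, w i * Real.log (z i) ≤ Real.log c := by
  have h1 : ∀ i ∈ s, w i * Real.log (z i) ≤ w i * Real.log c + (w i * z i / c - w i) := by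
    intro i hi
    rcases (hw i hi).eq_or_lt with h0 | h0
    · simp [← h0]
    · have hzi := hz i hi h0
      have h2 := Real.log_le_sub_one_of_pos (div_pos hzi hc)
      rw [Real.log_div hzi.ne' hc.ne'] at h2
      have h3 := mul_le_mul_of_nonneg_left h2 h0.le
      have h4 : w i * (z i / c - 1) = w i * z i / c - w i := by ring
      nlinarith
  refine (Finset.sum_le_sum h1).trans ?_
  rw [Finset.sum_add_distrib, ← Finset.sum_mul, hw1, Finset.sum_sub_distrib, hw1,
    ← Finset.sum_div]
  have : (∑ i ∈ s, w i * z i) / c ≤ 1 := (div_le_one hc).2 h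
  linarith

section entropy

variable {V : Type*} [Fintype V]

/-- The entropy of the first `n` entries. -/
noncomputable def tupleEntropy (p : List V → ℝ) (n : ℕ) : ℝ :=
  ∑ u : Fin n → V, Real.negMulLog (p (List.ofFn u))

/-- The entropy of one entry conditioned on `n` others. -/
noncomputable def condEntropy (p : List V → ℝ) (n : ℕ) : ℝ :=
  tupleEntropy p (n + 1) - tupleEntropy p n

open Classical in
/-- Let `w_n, …, w_1` be independent with law `p (· | v)`. This is the probability that every
`w_m` has positive probability given the current state, where the state starts as `u` and
`w_m` is added to it whenever `B m` holds. -/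
noncomputable def chainProb (p : List V → ℝ) (v : List V) (B : ℕ → Prop) : ℕ → List V → ℝ
  | 0, _ => 1
  | n + 1, u => ∑ x, if 0 < p (x :: u) then
      p (x :: v) / p v * chainProb p v B n (if B (n + 1) then x :: u else u) else 0

open Classical in
/-- The event whose probability is `chainProb`. -/
def ChainGood (p : List V → ℝ) (B : ℕ → Prop) (w : ℕ → V) : ℕ → List V → Prop
  | 0, _ => True
  | n + 1, u => 0 < p (w (n + 1) :: u) ∧
      ChainGood p B w n (if B (n + 1) then w (n + 1) :: u else u)

open Classical in
/-- The lower bound for the expected logarithm of `chainProb`. -/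
noncomputable def chainBound (p : List V → ℝ) (q : ℕ) (B : ℕ → Prop) : ℕ → ℕ → ℝ
  | 0, _ => 0
  | n + 1, l => condEntropy p (l + q) - condEntropy p q +
      chainBound p q B n (if B (n + 1) then l + 1 else l)

theorem chainGood_congr {W : Type*} (p : List W → ℝ) (B : ℕ → Prop) (w w' : ℕ → W) (n : ℕ)
    (u : List W) (h : ∀ m ≤ n, w m = w' m) : ChainGood p B w n u ↔ ChainGood p B w' n u := by
  induction n generalizing u with
  | zero => simp [ChainGood]
  | succ n ih =>
    simp only [ChainGood]
    rw [h (n + 1) le_rfl, ih _ fun m hm => h m (hm.trans (Nat.le_succ n))]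

-- The same independent draws `w` serve every index, so the left side is the expected number of good
-- indices, which `h` bounds pointwise. The induction conditions on the first draw `w (n + 1) = x`
-- and keeps the indices that survive it.
open Classical in
theorem sum_chainProb_le (p : List V → ℝ) (v : List V) (hp : ∀ u, 0 ≤ p u)
    (hv : ∑ x, p (x :: v) / p v = 1) {ι : Type*} (B : ι → ℕ → Prop) (a : ℕ) (n : ℕ)
    (T : Finset ι) (u : ι → List V)
    (h : ∀ w : ℕ → V, (T.filter fun i => ChainGood p (B i) w n (u i)).card ≤ a) :
    ∑ i ∈ T, chainProb p v (B i) n (u i) ≤ a := by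
  induction n generalizing T u with
  | zero =>
    have hV : Nonempty V := by
      by_contra hV
      rw [not_nonempty_iff] at hV
      simp at hv
    have h0 := h fun _ => Classical.arbitrary V
    rw [Finset.filter_true_of_mem (p := fun i => ChainGood p (B i) _ 0 (u i))
      fun i _ => trivial] at h0
    simpa [chainProb] using h0
  | succ n ih =>
    simp only [chainProb]
    rw [Finset.sum_comm]
    calc _ ≤ ∑ x, p (x :: v) / p v * a := by
          refine Finset.sum_le_sum fun x _ => ?_
          rw [← Finset.sum_filter, ← Finset.mul_sum]
          refine mul_le_mul_of_nonneg_left ?_ (div_nonneg (hp _) (hp _))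
          refine ih _ _ fun w => ?_
          refine le_trans (Finset.card_le_card ?_) (h (Function.update w (n + 1) x))
          intro i
          simp only [Finset.mem_filter, ChainGood, Function.update_self]
          rintro ⟨⟨h1, h2⟩, h3⟩
          refine ⟨h1, h2, (chainGood_congr p (B i) _ _ n _ fun m hm => ?_).2 h3⟩
          rw [Function.update_of_ne (by omega)]
      _ = a := by rw [← Finset.sum_mul, hv, one_mul]

end entropy

namespace IsExchangeable

variable {V : Type*} [Fintype V] {k : ℕ} {p : List V → ℝ}

theorem cons_le (hp : IsExchangeable k p) (x : V) (u : List V) (hu : u.length < k) :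
    p (x :: u) ≤ p u := by
  rw [← hp.sum_cons u hu]
  exact Finset.single_le_sum (f := fun x => p (x :: u)) (fun x _ => hp.nonneg _)
    (Finset.mem_univ x)

theorem cons_drop_pos (hp : IsExchangeable k p) (x : V) (u : List V) (l : ℕ)
    (hu : u.length < k) (h : 0 < p (x :: u)) : 0 < p (x :: u.drop l) := by
  induction l generalizing u with
  | zero => simpa using h
  | succ l ih =>
    cases u with
    | nil => simpa using h
    | cons y u =>
      simp only [List.length_cons] at hu
      rw [List.drop_succ_cons]
      refine ih u (by omega) (h.trans_le ?_)
      rw [hp.perm _ _ (List.Perm.swap y x u)]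
      exact hp.cons_le _ _ (by simp; omega)

theorem drop_pos (hp : IsExchangeable k p) (u : List V) (l : ℕ)
    (hu : u.length ≤ k) (h : 0 < p u) : 0 < p (u.drop l) := by
  induction l generalizing u with
  | zero => simpa using h
  | succ l ih =>
    cases u with
    | nil => simpa using h
    | cons y u =>
      simp only [List.length_cons] at hu
      rw [List.drop_succ_cons]
      exact ih u (by omega) (h.trans_le (hp.cons_le _ _ (by omega)))

theorem exists_cons_pos (hp : IsExchangeable k p) (u : List V) (hu : u.length < k)
    (h : 0 < p u) : ∃ x, 0 < p (x :: u) := by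
  by_contra! hx
  rw [← hp.sum_cons u hu] at h
  exact absurd (Finset.sum_nonpos fun x _ => hx x) (not_le.2 h)

theorem sum_eq_one (hp : IsExchangeable k p) (n : ℕ) (hn : n ≤ k) :
    ∑ u : Fin n → V, p (List.ofFn u) = 1 := by
  induction n with
  | zero => simp [hp.nil]
  | succ n ih =>
    rw [sum_ofFn_succ, ← ih (by omega)]
    exact Finset.sum_congr rfl fun u _ => hp.sum_cons _ (by simp; omega)

/-- Marginals: forgetting the first `l` of the conditioning entries. -/
theorem sum_cons_drop (hp : IsExchangeable k p) (q l : ℕ) (hl : l + q < k) (x : V)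
    (f : List V → ℝ) :
    ∑ u : Fin (l + q) → V, p (x :: List.ofFn u) * f ((List.ofFn u).drop l) =
      ∑ v : Fin q → V, p (x :: List.ofFn v) * f (List.ofFn v) := by
  induction l with
  | zero => rw [Nat.zero_add]; simp
  | succ l ih =>
    rw [← ih (by omega), show l + 1 + q = l + q + 1 by omega,
      sum_ofFn_succ _ fun u => p (x :: u) * f (u.drop (l + 1))]
    refine Finset.sum_congr rfl fun u _ => ?_
    simp only [List.drop_succ_cons]
    rw [← Finset.sum_mul, ← hp.sum_cons (x :: List.ofFn u) (by simp; omega)]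
    congr 1
    exact Finset.sum_congr rfl fun y _ => hp.perm _ _ (List.Perm.swap y x _)

theorem sum_cons_mul_log (hp : IsExchangeable k p) (q : ℕ) (hq : q < k) :
    ∑ u : Fin q → V, ∑ x, p (x :: List.ofFn u) *
      (Real.log (p (x :: List.ofFn u)) - Real.log (p (List.ofFn u))) = - condEntropy p q := by
  simp only [condEntropy, tupleEntropy]
  rw [sum_ofFn_succ q fun u => Real.negMulLog (p u)]
  simp only [mul_sub, Finset.sum_sub_distrib, Real.negMulLog, neg_mul, Finset.sum_neg_distrib]
  have : ∀ u : Fin q → V, ∑ x, p (x :: List.ofFn u) * Real.log (p (List.ofFn u)) =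
      p (List.ofFn u) * Real.log (p (List.ofFn u)) := fun u => by
    rw [← Finset.sum_mul, hp.sum_cons _ (by simpa using hq)]
  simp only [this]
  ring

/-- The length condition leaves room: every state met is a possible list shorter than `k`, so some
`x` extends it, and this `x` is also possible after `v`, a suffix of the state. -/
theorem chainProb_pos (hp : IsExchangeable k p) (l : ℕ) (B : ℕ → Prop) (n : ℕ) (u v : List V)
    (hv : 0 < p v) (h : 0 < p u)
    (huv : v = u.drop l) (hk : u.length + (open Classical in
      ((Finset.Icc 1 n).filter B).card) < k) : 0 < chainProb p v B n u := by
  classical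
  induction n generalizing u l with
  | zero => simp [chainProb]
  | succ n ih =>
    simp only [chainProb]
    have hnn : ∀ n u, 0 ≤ chainProb p v B n u := by
      intro n
      induction n with
      | zero => intro u; simp [chainProb]
      | succ n ih =>
        intro u
        simp only [chainProb]
        refine Finset.sum_nonneg fun x _ => ?_
        split_ifs
        · exact mul_nonneg (div_nonneg (hp.nonneg _) (hp.nonneg _)) (ih _)
        · exact mul_nonneg (div_nonneg (hp.nonneg _) (hp.nonneg _)) (ih _)
        · exact le_rfl
    have hul : u.length < k := by omega
    obtain ⟨x, hx⟩ := hp.exists_cons_pos u hul h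
    refine Finset.sum_pos' (fun x _ => ?_) ⟨x, Finset.mem_univ x, ?_⟩
    · split_ifs
      · exact mul_nonneg (div_nonneg (hp.nonneg _) (hp.nonneg _)) (hnn _ _)
      · exact mul_nonneg (div_nonneg (hp.nonneg _) (hp.nonneg _)) (hnn _ _)
      · exact le_rfl
    · rw [if_pos hx]
      have hxv : 0 < p (x :: v) := huv ▸ hp.cons_drop_pos x u l hul hx
      refine mul_pos (div_pos hxv hv) ?_
      rw [← Finset.insert_Icc_right_eq_Icc_add_one (by omega), Finset.filter_insert] at hk
      by_cases hB : B (n + 1)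
      · rw [if_pos hB] at hk ⊢
        rw [Finset.card_insert_of_notMem (by simp)] at hk
        exact ih (l + 1) (x :: u) hx (by simpa using huv) (by simp; omega)
      · rw [if_neg hB] at hk ⊢
        exact ih l u h huv hk

/-- The expected logarithm of `chainProb` is at least `chainBound`. -/
theorem chainBound_le (hp : IsExchangeable k p) (q : ℕ) (B : ℕ → Prop) (n l : ℕ)
    (hk : l + q + (open Classical in ((Finset.Icc 1 n).filter B).card) < k) :
    chainBound p q B n l ≤ ∑ u : Fin (l + q) → V, p (List.ofFn u) *
      Real.log (chainProb p ((List.ofFn u).drop l) B n (List.ofFn u)) := by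
  classical
  induction n generalizing l with
  | zero => simp [chainBound, chainProb]
  | succ n ih =>
    have hlk : l + q < k := by omega
    -- One step of the chain. `chainProb` is at least the average over x ∼ p(· | U) of the
    -- likelihood ratio p(x | v)/p(x | U) times the remaining probability, and Jensen moves the
    -- logarithm inside. The ratio produces the entropy difference.
    have key : ∀ u : Fin (l + q) → V, ∑ x, p (x :: List.ofFn u) *
        ((Real.log (p (x :: (List.ofFn u).drop l)) - Real.log (p ((List.ofFn u).drop l))) -
          (Real.log (p (x :: List.ofFn u)) - Real.log (p (List.ofFn u))) +
          Real.log (chainProb p ((List.ofFn u).drop l) B n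
            (if B (n + 1) then x :: List.ofFn u else List.ofFn u))) ≤
        p (List.ofFn u) *
          Real.log (chainProb p ((List.ofFn u).drop l) B (n + 1) (List.ofFn u)) := by
      intro u
      set U := List.ofFn u with hU
      have hUl : U.length = l + q := by simp [hU]
      rcases (hp.nonneg U).eq_or_lt with h0 | h0
      · rw [← h0, zero_mul]
        refine le_of_eq (Finset.sum_eq_zero fun x _ => ?_)
        have : p (x :: U) = 0 :=
          le_antisymm (h0 ▸ hp.cons_le x U (by omega)) (hp.nonneg _)
        rw [this, zero_mul]
      · have hv : 0 < p (U.drop l) := hp.drop_pos U l (by omega) h0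
        have hpos := hp.chainProb_pos l B (n + 1) U (U.drop l) hv h0 rfl (by omega)
        have hstep : ∀ x, 0 < p (x :: U) → 0 < chainProb p (U.drop l) B n
            (if B (n + 1) then x :: U else U) := by
          intro x hx
          rw [← Finset.insert_Icc_right_eq_Icc_add_one (by omega), Finset.filter_insert] at hk
          by_cases hB : B (n + 1)
          · rw [if_pos hB] at hk ⊢
            rw [Finset.card_insert_of_notMem (by simp)] at hk
            exact hp.chainProb_pos (l + 1) B n (x :: U) _ hv hx (by simp) (by simp; omega)
          · rw [if_neg hB] at hk ⊢
            exact hp.chainProb_pos l B n U _ hv h0 rfl (by omega)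
        have hxv : ∀ x, 0 < p (x :: U) → 0 < p (x :: U.drop l) := fun x hx =>
          hp.cons_drop_pos x U l (by omega) hx
        have := sum_mul_log_le_log Finset.univ (fun x => p (x :: U) / p U)
          (fun x => p (x :: U.drop l) / p (U.drop l) / (p (x :: U) / p U) *
            chainProb p (U.drop l) B n (if B (n + 1) then x :: U else U)) _ hpos
          (fun x _ => div_nonneg (hp.nonneg _) (hp.nonneg _))
          (by rw [← Finset.sum_div, hp.sum_cons U (by omega), div_self h0.ne'])
          (fun x _ hx => by
            have hx' : 0 < p (x :: U) := (div_pos_iff_of_pos_right h0).1 hx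
            exact mul_pos (div_pos (div_pos (hxv x hx') hv) hx) (hstep x hx'))
          (by
            rw [chainProb]
            refine Finset.sum_le_sum fun x _ => ?_
            by_cases hx : 0 < p (x :: U)
            · rw [if_pos hx]
              apply le_of_eq
              field_simp
            · have : p (x :: U) = 0 := le_antisymm (not_lt.1 hx) (hp.nonneg _)
              simp [this])
        refine le_trans (le_of_eq ?_) (mul_le_mul_of_nonneg_left this h0.le)
        rw [Finset.mul_sum]
        refine Finset.sum_congr rfl fun x _ => ?_
        rw [← mul_assoc, mul_div_cancel₀ _ h0.ne']
        rcases (hp.nonneg (x :: U)).eq_or_lt with h1 | h1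
        · simp [← h1]
        · have h2 := hxv x h1
          have h3 := hstep x h1
          rw [Real.log_mul (by positivity) h3.ne', Real.log_div (by positivity) (by positivity),
            Real.log_div h2.ne' hv.ne', Real.log_div h1.ne' h0.ne']
    refine le_trans ?_ (Finset.sum_le_sum fun u _ => key u)
    simp only [mul_add, mul_sub, Finset.sum_add_distrib, Finset.sum_sub_distrib]
    have e1 := hp.sum_cons_mul_log (l + q) hlk
    have e2 := hp.sum_cons_mul_log q (by omega)
    simp only [mul_sub, Finset.sum_sub_distrib] at e1 e2
    -- Terms seeing only `x` and the last `q` entries: the first `l` entries are summed out, which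
    -- turns them into the conditional entropy at level `q`.
    have e3 : ∀ F : V → List V → ℝ,
        ∑ u : Fin (l + q) → V, ∑ x, p (x :: List.ofFn u) * F x ((List.ofFn u).drop l) =
          ∑ u : Fin q → V, ∑ x, p (x :: List.ofFn u) * F x (List.ofFn u) := by
      intro F
      rw [Finset.sum_comm, Finset.sum_comm (s := (Finset.univ : Finset (Fin q → V)))]
      exact Finset.sum_congr rfl fun x _ => hp.sum_cons_drop q l hlk x (F x)
    rw [e3 fun x v => Real.log (p (x :: v)), e3 fun _ v => Real.log (p v)]
    rw [chainBound]
    rw [← Finset.insert_Icc_right_eq_Icc_add_one (by omega), Finset.filter_insert] at hk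
    by_cases hB : B (n + 1)
    · simp only [if_pos hB] at hk ⊢
      rw [Finset.card_insert_of_notMem (by simp)] at hk
      have := ih (l + 1) (by omega)
      rw [show l + 1 + q = l + q + 1 by omega,
        sum_ofFn_succ _ fun u => p u * Real.log (chainProb p (u.drop (l + 1)) B n u)] at this
      simp only [List.drop_succ_cons] at this
      linarith
    · simp only [if_neg hB] at hk ⊢
      have := ih l hk
      have e4 : ∀ u : Fin (l + q) → V, ∑ x, p (x :: List.ofFn u) *
          Real.log (chainProb p ((List.ofFn u).drop l) B n (List.ofFn u)) = p (List.ofFn u) *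
          Real.log (chainProb p ((List.ofFn u).drop l) B n (List.ofFn u)) := fun u => by
        rw [← Finset.sum_mul, hp.sum_cons _ (by simpa using hlk)]
      simp only [e4]
      linarith

end IsExchangeable

/-! ### An extremal problem for sequences -/

/-- A Chebyshev-type inequality: `w` increases, and each `σ m` is at least the mean of the
preceding terms. -/
theorem sum_mul_sum_le_of_mean_le (σ w : ℕ → ℝ) (n : ℕ)
    (hσ : ∀ m < n, ∑ j ∈ Finset.range m, σ j ≤ m * σ m)
    (hw : ∀ m < n, ∑ j ∈ Finset.range m, w j ≤ m * w m) :
    (∑ j ∈ Finset.range n, σ j) * ∑ j ∈ Finset.range n, w j ≤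
      n * ∑ j ∈ Finset.range n, w j * σ j := by
  induction n with
  | zero => simp
  | succ m ih =>
    have ih := ih (fun l hl => hσ l (by omega)) fun l hl => hw l (by omega)
    have h1 := hσ m (by omega)
    have h2 := hw m (by omega)
    rw [Finset.sum_range_succ, Finset.sum_range_succ, Finset.sum_range_succ]
    rcases Nat.eq_zero_or_pos m with rfl | hm
    · simp [mul_comm]
    · have hm' : (0 : ℝ) < m := by exact_mod_cast hm
      push_cast
      set S := ∑ j ∈ Finset.range m, σ j
      set W := ∑ j ∈ Finset.range m, w j
      set C := ∑ j ∈ Finset.range m, w j * σ j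
      -- `m` times the goal is `m + 1` times the induction hypothesis plus this product.
      have h3 : 0 ≤ (m * σ m - S) * (m * w m - W) :=
        mul_nonneg (by linarith) (by linarith)
      refine le_of_mul_le_mul_left ?_ hm'
      nlinarith

/-- As a function of t = log z, log(1 - e^t) is concave; this is its tangent line at t = log y. -/
theorem log_one_sub_le {y z : ℝ} (hy : 0 < y) (hy1 : y < 1) (hz : 0 < z) (hz1 : z < 1) :
    Real.log (1 - z) - Real.log (1 - y) ≤ -(y / (1 - y)) * (Real.log z - Real.log y) := by
  have h1 := Real.log_le_sub_one_of_pos (div_pos hz hy)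
  have h2 := Real.log_le_sub_one_of_pos (div_pos (sub_pos.2 hz1) (sub_pos.2 hy1))
  rw [Real.log_div hz.ne' hy.ne'] at h1
  rw [Real.log_div (sub_pos.2 hz1).ne' (sub_pos.2 hy1).ne'] at h2
  have hy' : 0 < 1 - y := sub_pos.2 hy1
  have h3 : y / (1 - y) * (Real.log z - Real.log y) ≤ y / (1 - y) * (z / y - 1) :=
    mul_le_mul_of_nonneg_left h1 (div_pos hy hy').le
  have h4 : y / (1 - y) * (z / y - 1) + ((1 - z) / (1 - y) - 1) = 0 := by
    field_simp
    ring
  linarith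

/-- The equality case: for x_j = a + j + 1 the factor x_j/(x_i - x_j) is (a + j + 1)/(i - j), so
every constraint of the extremal problem is tight. -/
theorem prod_range_div_eq_choose (a i : ℕ) :
    ∏ j ∈ Finset.range i, (((a : ℝ) + j + 1) / ((i : ℝ) - j)) = ((a + i).choose i : ℝ) := by
  have h1 : ∏ j ∈ Finset.range i, ((i : ℝ) - j) = (i.factorial : ℝ) := by
    rw [← Finset.prod_range_reflect, ← Finset.prod_range_add_one_eq_factorial]
    push_cast
    refine Finset.prod_congr rfl fun j hj => ?_
    have hj := Finset.mem_range.1 hj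
    rw [Nat.cast_sub (by omega), Nat.cast_sub (by omega)]
    push_cast
    ring
  have h2 : ∏ j ∈ Finset.range i, ((a : ℝ) + j + 1) = ((a + 1).ascFactorial i : ℝ) := by
    rw [Nat.ascFactorial_eq_prod_range]
    push_cast
    exact Finset.prod_congr rfl fun j _ => by ring
  rw [Finset.prod_div_distrib, h1, h2, Nat.ascFactorial_eq_factorial_mul_choose]
  push_cast
  field_simp

/-- If `∏_{j<i} x_j / (x_i - x_j) ≤ C(a + i, i)` for all `i`, where `x_j = exp ξ_j`, then
`∏_{j<i} x_j / x_i` is at most the value it has for `x_j = a + j + 1`. -/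
theorem sum_sub_le_of_prod_le_choose (a k : ℕ) (ξ : ℕ → ℝ)
    (h1 : ∀ i < k, ∀ j < i, ξ j < ξ i)
    (h2 : ∀ i < k, ∏ j ∈ Finset.range i,
      (Real.exp (ξ j - ξ i) / (1 - Real.exp (ξ j - ξ i))) ≤ ((a + i).choose i : ℝ))
    (i : ℕ) (hi : i < k) :
    ∑ j ∈ Finset.range i, (ξ j - Real.log (a + j + 1)) ≤ i * (ξ i - Real.log (a + i + 1)) := by
  induction i using Nat.strong_induction_on with
  | _ i ih =>
  by_contra! hcon
  rcases Nat.eq_zero_or_pos i with rfl | hi0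
  · simp at hcon
  -- `s` is the deviation from the extremal sequence and `σ` is its difference from the value at
  -- `i`; `y` and `w` are the extremal values of x_j/x_i and of x_j/(x_i - x_j). The negated goal
  -- says that `σ` has positive sum.
  set s : ℕ → ℝ := fun j => ξ j - Real.log (a + j + 1) with hs
  set σ : ℕ → ℝ := fun j => s j - s i with hσ
  set y : ℕ → ℝ := fun j => ((a : ℝ) + j + 1) / (a + i + 1) with hy
  set w : ℕ → ℝ := fun j => ((a : ℝ) + j + 1) / ((i : ℝ) - j) with hw
  have hpos : ∀ j : ℕ, (0 : ℝ) < a + j + 1 := fun j => by positivity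
  have hij : ∀ j < i, (0 : ℝ) < (i : ℝ) - j := fun j hj => by
    rw [sub_pos]; exact_mod_cast hj
  have hy0 : ∀ j, 0 < y j := fun j => div_pos (hpos j) (hpos i)
  have hy1 : ∀ j < i, y j < 1 := fun j hj => by
    rw [hy]
    simp only
    rw [div_lt_one (hpos i)]
    have := hij j hj
    linarith
  have hyw : ∀ j < i, y j / (1 - y j) = w j := fun j hj => by
    have := hpos i
    have h3 := hij j hj
    have h4 : 1 - y j = ((i : ℝ) - j) / (a + i + 1) := by
      simp only [hy]
      field_simp
      ring
    rw [h4]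
    simp only [hy, hw]
    field_simp
  have hS : 0 < ∑ j ∈ Finset.range i, σ j := by
    simp only [hσ, Finset.sum_sub_distrib, Finset.sum_const, Finset.card_range, nsmul_eq_mul]
    linarith
  -- The induction hypothesis; subtracting the constant `s i` does not affect a comparison with the
  -- mean.
  have hσm : ∀ m < i, ∑ j ∈ Finset.range m, σ j ≤ m * σ m := by
    intro m hm
    have := ih m hm (by omega)
    simp only [hσ, Finset.sum_sub_distrib, Finset.sum_const, Finset.card_range, nsmul_eq_mul]
    simp only [hs, Finset.sum_sub_distrib] at this ⊢
    linarith
  have hw0 : ∀ j < i, 0 < w j := fun j hj => div_pos (hpos j) (hij j hj)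
  have hwm : ∀ m < i, ∑ j ∈ Finset.range m, w j ≤ m * w m := by
    intro m hm
    have := Finset.sum_le_card_nsmul (Finset.range m) w (w m) fun j hj => by
      have hj := Finset.mem_range.1 hj
      have hjm : (j : ℝ) ≤ m := by exact_mod_cast hj.le
      exact div_le_div₀ (hpos m).le (by linarith) (hij m hm) (by linarith)
    simpa using this
  have hcheb := sum_mul_sum_le_of_mean_le σ w i hσm hwm
  have hC : 0 ≤ ∑ j ∈ Finset.range i, w j * σ j := by
    have h3 : 0 ≤ (i : ℝ) * ∑ j ∈ Finset.range i, w j * σ j :=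
      le_trans (mul_nonneg hS.le
        (Finset.sum_nonneg fun j hj => (hw0 j (Finset.mem_range.1 hj)).le)) hcheb
    exact (mul_nonneg_iff_of_pos_left (by exact_mod_cast hi0)).1 h3
  set z : ℕ → ℝ := fun j => Real.exp (ξ j - ξ i) with hz
  have hz0 : ∀ j, 0 < z j := fun j => Real.exp_pos _
  have hz1 : ∀ j < i, z j < 1 := fun j hj => by
    simp only [hz]
    rw [Real.exp_lt_one_iff]
    linarith [h1 i hi j hj]
  have hzy : ∀ j, Real.log (z j) - Real.log (y j) = σ j := fun j => by
    simp only [hz, hy, hσ, hs]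
    rw [Real.log_exp, Real.log_div (hpos j).ne' (hpos i).ne']
    ring
  have h3 := h2 i hi
  rw [← prod_range_div_eq_choose] at h3
  have h4 := Real.log_le_log (Finset.prod_pos fun j hj =>
    div_pos (hz0 j) (sub_pos.2 (hz1 j (Finset.mem_range.1 hj)))) h3
  rw [Real.log_prod fun j hj =>
      (div_pos (hz0 j) (sub_pos.2 (hz1 j (Finset.mem_range.1 hj)))).ne',
    Real.log_prod fun j hj => (hw0 j (Finset.mem_range.1 hj)).ne'] at h4
  -- By the tangent inequality, log(z/(1 - z)) exceeds its extremal value log w by at least σ + wσ.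
  -- The total excess is positive by `hS` and `hC`, contradicting the product constraint `h4`.
  have h5 : ∑ j ∈ Finset.range i, (σ j + w j * σ j) ≤
      ∑ j ∈ Finset.range i, (Real.log (z j / (1 - z j)) - Real.log (w j)) := by
    refine Finset.sum_le_sum fun j hj => ?_
    have hj := Finset.mem_range.1 hj
    have h6 := log_one_sub_le (hy0 j) (hy1 j hj) (hz0 j) (hz1 j hj)
    rw [← hyw j hj, Real.log_div (hz0 j).ne' (sub_pos.2 (hz1 j hj)).ne',
      Real.log_div (hy0 j).ne' (sub_pos.2 (hy1 j hj)).ne']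
    rw [hzy] at h6
    have := hzy j
    linarith
  rw [Finset.sum_sub_distrib, Finset.sum_add_distrib] at h5
  linarith

/-! ### Geometric sums -/

theorem tendsto_sum_Icc_pow {y : ℝ} (hy : 0 ≤ y) (hy1 : y < 1) :
    Tendsto (fun M : ℕ => ∑ g ∈ Finset.Icc 1 M, y ^ g) atTop (𝓝 (y / (1 - y))) := by
  have h := ((hasSum_geometric_of_lt_one hy hy1).mul_left y).tendsto_sum_nat
  rw [← div_eq_mul_inv] at h
  refine h.congr fun M => ?_
  rw [Finset.range_eq_Ico, Finset.sum_Ico_eq_sum_range, ← Finset.Ico_add_one_right_eq_Icc,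
    Finset.sum_Ico_eq_sum_range]
  exact Finset.sum_congr (by simp) fun j _ => by ring

/-- If `y j ≥ 1`, the factor at `j` is at least `M`, while each other factor is at least its first
term; the product would be unbounded. -/
theorem lt_one_of_prod_sum_pow_le {i : ℕ} (y : ℕ → ℝ) (hy : ∀ j, 0 < y j) (c : ℝ)
    (h : ∀ M : ℕ, 1 ≤ M → ∏ j ∈ Finset.range i, ∑ g ∈ Finset.Icc 1 M, y j ^ g ≤ c)
    (j : ℕ) (hj : j < i) : y j < 1 := by
  by_contra! hj1
  have hj' := Finset.mem_range.2 hj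
  set P := ∏ l ∈ (Finset.range i).erase j, y l with hP
  have hP0 : 0 < P := Finset.prod_pos fun l _ => hy l
  obtain ⟨M, hM⟩ := exists_nat_gt (c / P)
  have h1 := h (M + 1) (by omega)
  rw [← Finset.mul_prod_erase _ _ hj'] at h1
  have h2 : P ≤ ∏ l ∈ (Finset.range i).erase j, ∑ g ∈ Finset.Icc 1 (M + 1), y l ^ g := by
    refine Finset.prod_le_prod (fun l _ => (hy l).le) fun l _ => ?_
    have := Finset.single_le_sum (f := fun g => y l ^ g) (s := Finset.Icc 1 (M + 1))
      (fun g _ => (pow_pos (hy l) g).le) (Finset.mem_Icc.2 ⟨le_rfl, by omega⟩)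
    simpa using this
  have h3 : (M : ℝ) ≤ ∑ g ∈ Finset.Icc 1 (M + 1), y j ^ g := by
    have := Finset.card_nsmul_le_sum (Finset.Icc 1 (M + 1)) (fun g => y j ^ g) 1
      fun g _ => one_le_pow₀ hj1
    simp at this
    linarith
  have h4 : (M : ℝ) * P ≤ c :=
    le_trans (mul_le_mul h3 h2 hP0.le ((Nat.cast_nonneg M).trans h3)) h1
  rw [div_lt_iff₀ hP0] at hM
  linarith

theorem prod_div_one_sub_le {i : ℕ} (y : ℕ → ℝ) (hy : ∀ j, 0 < y j) (c : ℝ)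
    (h : ∀ M : ℕ, 1 ≤ M → ∏ j ∈ Finset.range i, ∑ g ∈ Finset.Icc 1 M, y j ^ g ≤ c) :
    ∏ j ∈ Finset.range i, (y j / (1 - y j)) ≤ c := by
  refine le_of_tendsto (tendsto_finsetProd _ fun j hj => tendsto_sum_Icc_pow (hy j).le
    (lt_one_of_prod_sum_pow_le y hy c h j (Finset.mem_range.1 hj)))
    (eventually_atTop.2 ⟨1, h⟩)

/-! ### The bound for a single threshold vector -/

theorem chainBound_add {V : Type*} [Fintype V] (p : List V → ℝ) (q : ℕ) (B : ℕ → Prop)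
    (b d l : ℕ) (hB : ∀ m, b < m → m ≤ b + d → ¬ B m) :
    chainBound p q B (b + d) l =
      d * (condEntropy p (l + q) - condEntropy p q) + chainBound p q B b l := by
  induction d with
  | zero => simp
  | succ d ih =>
    rw [← add_assoc, chainBound, if_neg (hB _ (by omega) (by omega)),
      ih fun m h1 h2 => hB m h1 (by omega)]
    push_cast
    ring

/-- As m runs downwards, the thresholds in the state throughout [t_j, t_{j+1}) are exactly t_{j+1},
…, t_i, because w_{t_j} is tested before it is added. Each such interval thus contributes its length
times one entropy difference. -/
theorem chainBound_thresholds {V : Type*} [Fintype V] (p : List V → ℝ) (q : ℕ)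
    (B : ℕ → Prop) (i : ℕ) (t : ℕ → ℕ) (ht0 : t 0 = 1) (ht : ∀ j ≤ i, t j < t (j + 1))
    (hB : ∀ m, B m ↔ ∃ j, 0 < j ∧ j ≤ i ∧ t j = m) (j : ℕ) (hj : j ≤ i) :
    chainBound p q B (t (j + 1) - 1) (i - j) = ∑ l ∈ Finset.range (j + 1),
      ((t (l + 1) : ℝ) - t l) * (condEntropy p (i - l + q) - condEntropy p q) := by
  have hmono : ∀ a b, a < b → b ≤ i + 1 → t a < t b := by
    intro a b hab
    induction b, hab using Nat.le_induction with
    | base => intro h; exact ht a (by omega)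
    | succ b hb ih => intro h; exact (ih (by omega)).trans (ht b (by omega))
  have hnot : ∀ j ≤ i, ∀ m, t j < m → m < t (j + 1) → ¬ B m := by
    intro j hj m h1 h2 hm
    obtain ⟨l, hl0, hl, rfl⟩ := (hB m).1 hm
    rcases lt_trichotomy l j with h | rfl | h
    · exact absurd (hmono l j h (by omega)) (by omega)
    · omega
    · rcases Nat.lt_or_ge (j + 1) l with h' | h'
      · exact absurd (hmono _ _ h' (by omega)) (by omega)
      · obtain rfl : l = j + 1 := by omega
        omega
  induction j with
  | zero =>
    have h01 := ht 0 hj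
    rw [Nat.zero_add] at h01 ⊢
    obtain ⟨d, hd⟩ : ∃ d, t 1 = 1 + d := ⟨t 1 - 1, by omega⟩
    have h2 := chainBound_add p q B 0 d i fun m h1 h2 hm => by
      rcases Nat.lt_or_ge 1 m with h | h
      · exact hnot 0 (by omega) m (by omega) (by rw [Nat.zero_add]; omega) hm
      · obtain ⟨l, hl0, hl, hlm⟩ := (hB m).1 hm
        have := hmono 0 l hl0 (by omega)
        omega
    rw [hd, show 1 + d - 1 = 0 + d by omega, Nat.sub_zero, h2]
    simp [chainBound, ht0, hd]
  | succ j ih =>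
    rw [Finset.sum_range_succ, ← ih (by omega)]
    have h1 := ht (j + 1) hj
    have h0 := ht j (by omega)
    obtain ⟨d, hd⟩ : ∃ d, t (j + 1 + 1) = t (j + 1) + 1 + d := 
      ⟨t (j + 1 + 1) - (t (j + 1) + 1), by omega⟩
    rw [hd, show t (j + 1) + 1 + d - 1 = t (j + 1) + d by omega,
      chainBound_add p q B _ d _ fun m h2 h3 => hnot (j + 1) hj m h2 (by omega)]
    obtain ⟨b, hb⟩ : ∃ b, t (j + 1) = b + 1 := ⟨t (j + 1) - 1, by omega⟩
    have hBb : B (b + 1) := (hB _).2 ⟨j + 1, by omega, hj, hb⟩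
    rw [hb, chainBound, if_pos hBb, show i - (j + 1) + 1 = i - j by omega]
    rw [Nat.add_sub_cancel]
    push_cast
    ring

/-! ### Threshold vectors with bounded gaps -/

/-- The partial sums `1 + g 0 + ⋯ + g (j - 1)`, with last value `N + 1`. -/
def gapSum {i : ℕ} (N : ℕ) (g : Fin i → ℕ) (j : ℕ) : ℕ :=
  if j ≤ i then 1 + ∑ l : Fin i, (if (l : ℕ) < j then g l else 0) else N + 1

theorem gapSum_succ {i : ℕ} (N : ℕ) (g : Fin i → ℕ) (j : Fin i) :
    gapSum N g (j + 1) = gapSum N g j + g j := by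
  rw [gapSum, gapSum, if_pos (by omega), if_pos (by omega), add_assoc]
  congr 1
  rw [← Finset.sum_ite_eq' Finset.univ j g |>.trans (if_pos (Finset.mem_univ j)),
    ← Finset.sum_add_distrib]
  refine Finset.sum_congr rfl fun l _ => ?_
  rcases lt_trichotomy l j with h | rfl | h
  · rw [if_pos (by omega), if_pos (by omega), if_neg h.ne, add_zero]
  · simp
  · rw [if_neg (by omega), if_neg (by omega), if_neg h.ne', add_zero]

/-- The choice N = iM + 1 serves all gap vectors in [1, M]^i at once: t_i ≤ iM + 1 < N + 1, so the
implicit last gap is positive. -/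
theorem gapSum_lt {i : ℕ} (M : ℕ) (g : Fin i → ℕ) (hg : ∀ l, 1 ≤ g l ∧ g l ≤ M) (j : ℕ)
    (hj : j ≤ i) : gapSum (i * M + 1) g j < gapSum (i * M + 1) g (j + 1) := by
  rcases hj.eq_or_lt with rfl | hj
  · rw [gapSum, gapSum, if_pos le_rfl, if_neg (by omega)]
    have : ∑ l : Fin j, (if (l : ℕ) < j then g l else 0) ≤ j * M := by
      have := Finset.sum_le_card_nsmul Finset.univ
        (fun l : Fin j => if (l : ℕ) < j then g l else 0) M fun l _ => by
          rw [if_pos l.2]; exact (hg l).2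
      simpa using this
    omega
  · have := gapSum_succ (i * M + 1) g ⟨j, hj⟩
    simp only at this
    have := (hg ⟨j, hj⟩).1
    omega

theorem gapSum_mono {i : ℕ} (M : ℕ) (g : Fin i → ℕ) (hg : ∀ l, 1 ≤ g l ∧ g l ≤ M) :
    StrictMono fun l : Fin (i + 2) => gapSum (i * M + 1) g l := by
  rw [Fin.strictMono_iff_lt_succ]
  exact fun l => gapSum_lt M g hg l (by omega)

/-- The threshold vector with the given gaps. -/
def ForestIndex.ofGaps {i : ℕ} (M : ℕ) (g : Fin i → ℕ) (hg : ∀ l, 1 ≤ g l ∧ g l ≤ M) :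
    ForestIndex i (i * M + 1) where
  t l := gapSum (i * M + 1) g l
  strictMono := gapSum_mono M g hg
  t_zero := by simp [gapSum]
  t_last := by simp [gapSum]

theorem ForestIndex.ofGaps_injective {i : ℕ} (M : ℕ) (g g' : Fin i → ℕ)
    (hg : ∀ l, 1 ≤ g l ∧ g l ≤ M) (hg' : ∀ l, 1 ≤ g' l ∧ g' l ≤ M)
    (h : ForestIndex.ofGaps M g hg = ForestIndex.ofGaps M g' hg') : g = g' := by
  have ht : ∀ l : Fin (i + 2), gapSum (i * M + 1) g l = gapSum (i * M + 1) g' l :=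
    fun l => congrFun (congrArg ForestIndex.t h) l
  funext j
  have h1 := gapSum_succ (i * M + 1) g j
  have h2 := gapSum_succ (i * M + 1) g' j
  have h3 := ht ⟨j, by omega⟩
  have h4 := ht ⟨j + 1, by omega⟩
  simp only at h3 h4
  omega

/-- `m` is one of `t_1, …, t_i`. -/
def ForestIndex.IsThreshold {i N : ℕ} (τ : ForestIndex i N) (m : ℕ) : Prop :=
  ∃ l : Fin (i + 2), 0 < l ∧ l < Fin.last (i + 1) ∧ τ.t l = m

open Classical in
theorem ForestIndex.card_isThreshold_le {i N : ℕ} (τ : ForestIndex i N) :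
    ((Finset.Icc 1 N).filter τ.IsThreshold).card ≤ i := by
  refine (Finset.card_le_card (t := (Finset.Ioo 0 (Fin.last (i + 1))).image τ.t)
    fun m hm => ?_).trans (Finset.card_image_le.trans (by simp))
  obtain ⟨l, h1, h2, h3⟩ := (Finset.mem_filter.1 hm).2
  exact Finset.mem_image.2 ⟨l, Finset.mem_Ioo.2 ⟨h1, h2⟩, h3⟩

/-- On the last interval [t_i, N + 1) the state is `v` alone and the entropy difference is zero, so
the last gap costs nothing and only the `i` free gaps appear. -/
theorem ForestIndex.chainBound_ofGaps {V : Type*} [Fintype V] (p : List V → ℝ) (q : ℕ) {i : ℕ}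
    (M : ℕ) (g : Fin i → ℕ) (hg : ∀ l, 1 ≤ g l ∧ g l ≤ M) :
    chainBound p q (ForestIndex.ofGaps M g hg).IsThreshold (i * M + 1) 0 =
      ∑ l : Fin i, (g l : ℝ) * (condEntropy p (i - l + q) - condEntropy p q) := by
  have h := chainBound_thresholds p q (ForestIndex.ofGaps M g hg).IsThreshold i
    (gapSum (i * M + 1) g) (by simp [gapSum]) (gapSum_lt M g hg) (fun m => by
      constructor
      · rintro ⟨l, h1, h2, h3⟩
        exact ⟨l, h1, by have := Fin.lt_def.1 h2; simp at this; omega, h3⟩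
      · rintro ⟨j, h1, h2, h3⟩
        exact ⟨⟨j, by omega⟩, by simpa [Fin.lt_def] using h1,
          by simp only [Fin.lt_def, Fin.val_last]; omega, h3⟩) i le_rfl
  rw [Nat.sub_self, Finset.sum_range_succ] at h
  simp only [Nat.sub_self, Nat.zero_add, sub_self, mul_zero, add_zero] at h
  rw [show gapSum (i * M + 1) g (i + 1) - 1 = i * M + 1 by simp [gapSum]] at h
  rw [h, Finset.sum_range]
  refine Finset.sum_congr rfl fun l _ => ?_
  rw [gapSum_succ]
  push_cast
  ring

/-! ### The bound for the entropy of an exchangeable law -/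

namespace IsExchangeable

variable {V : Type*} [Fintype V] {k : ℕ} {p : List V → ℝ}

-- A second use of Jensen, over the law of `v`, turns the bound on the expected logarithm into one
-- on the expected probability; the sum over `T` is then bounded for each `v` by `sum_chainProb_le`.
open Classical in
theorem sum_exp_chainBound_le (hp : IsExchangeable k p) (q : ℕ) (n a : ℕ) {ι : Type*}
    (T : Finset ι) (B : ι → ℕ → Prop)
    (hB : ∀ τ ∈ T, q + ((Finset.Icc 1 n).filter (B τ)).card < k)
    (h : ∀ (v : Fin q → V) (w : ℕ → V),
      (T.filter fun τ => ChainGood p (B τ) w n (List.ofFn v)).card ≤ a) :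
    ∑ τ ∈ T, Real.exp (chainBound p q (B τ) n 0) ≤ a := by
  rcases T.eq_empty_or_nonempty with rfl | ⟨τ₀, hτ₀⟩
  · simp
  have hq : q < k := by have := hB τ₀ hτ₀; omega
  have hpos : ∀ τ ∈ T, ∀ v : Fin q → V, 0 < p (List.ofFn v) →
      0 < chainProb p (List.ofFn v) (B τ) n (List.ofFn v) := fun τ hτ v hv =>
    hp.chainProb_pos 0 _ n _ _ hv hv rfl (by simpa using hB τ hτ)
  have hsum := hp.sum_eq_one q hq.le
  have h1 : ∀ τ ∈ T, Real.exp (chainBound p q (B τ) n 0) ≤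
      ∑ v : Fin q → V, p (List.ofFn v) *
        chainProb p (List.ofFn v) (B τ) n (List.ofFn v) := by
    intro τ hτ
    have h2 := hp.chainBound_le q (B τ) n 0 (by simpa using hB τ hτ)
    rw [Nat.zero_add] at h2
    simp only [List.drop_zero] at h2
    obtain ⟨v₀, -, hv₀⟩ : ∃ v ∈ Finset.univ, 0 < p (List.ofFn (n := q) v) := by
      by_contra! hcon
      have := Finset.sum_nonpos hcon
      rw [hsum] at this
      linarith
    have hterm : ∀ v : Fin q → V, 0 ≤ p (List.ofFn v) *
        chainProb p (List.ofFn v) (B τ) n (List.ofFn v) := fun v => by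
      rcases (hp.nonneg (List.ofFn v)).eq_or_lt with h0 | h0
      · rw [← h0, zero_mul]
      · exact (mul_pos h0 (hpos τ hτ v h0)).le
    have hc : 0 < ∑ v : Fin q → V, p (List.ofFn v) *
        chainProb p (List.ofFn v) (B τ) n (List.ofFn v) :=
      Finset.sum_pos' (fun v _ => hterm v) ⟨v₀, Finset.mem_univ _,
        mul_pos hv₀ (hpos τ hτ v₀ hv₀)⟩
    rw [← Real.le_log_iff_exp_le hc]
    exact h2.trans (sum_mul_log_le_log Finset.univ _ _ _ hc (fun v _ => hp.nonneg _) hsum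
      (fun v _ hv => hpos τ hτ v hv) le_rfl)
  refine (Finset.sum_le_sum h1).trans ?_
  rw [Finset.sum_comm]
  calc _ ≤ ∑ v : Fin q → V, p (List.ofFn v) * a := by
        refine Finset.sum_le_sum fun v _ => ?_
        rw [← Finset.mul_sum]
        rcases (hp.nonneg (List.ofFn v)).eq_or_lt with h0 | h0
        · rw [← h0, zero_mul, zero_mul]
        · refine mul_le_mul_of_nonneg_left ?_ h0.le
          exact sum_chainProb_le p _ hp.nonneg
            (by rw [← Finset.sum_div, hp.sum_cons _ (by simpa using hq), div_self h0.ne'])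
            B a n T _ (h v)
    _ = a := by rw [← Finset.sum_mul, hsum, one_mul]

open Classical in
/-- If no point lies in more than `a` of the events, then the conditional entropies satisfy the
corresponding product inequality. -/
theorem prod_exp_le (hp : IsExchangeable k p) (i a : ℕ) (hik : i < k)
    (h : ∀ (N : ℕ) (T : Finset (ForestIndex i N)) (v : Fin (k - i - 1) → V) (w : ℕ → V),
      (T.filter fun τ => ChainGood p τ.IsThreshold w N (List.ofFn v)).card ≤ a)
    (y : ℕ → ℝ) (hy : ∀ j, y j =
      Real.exp (condEntropy p (k - 1 - j) - condEntropy p (k - 1 - i))) (M : ℕ) :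
    ∏ j ∈ Finset.range i, ∑ g ∈ Finset.Icc 1 M, y j ^ g ≤ a := by
  -- Expanding the product gives one term for each gap vector in [1, M]^i, namely the lower bound
  -- attached to its threshold vector.
  rw [Finset.prod_range, Finset.prod_univ_sum]
  set P := Fintype.piFinset fun _ : Fin i => Finset.Icc 1 M with hP
  have hPg : ∀ g ∈ P, ∀ l, 1 ≤ g l ∧ g l ≤ M := fun g hg l =>
    Finset.mem_Icc.1 (Fintype.mem_piFinset.1 hg l)
  have h1 := hp.sum_exp_chainBound_le (k - i - 1) (i * M + 1) a
    (P.attach.image fun g => ForestIndex.ofGaps M g.1 (hPg g.1 g.2))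
    (fun τ => τ.IsThreshold) (fun τ _ => by have := τ.card_isThreshold_le; omega)
    (h _ _)
  rw [Finset.sum_image fun g _ g' _ hgg => Subtype.ext
    (ForestIndex.ofGaps_injective M _ _ _ _ hgg)] at h1
  refine le_trans (le_of_eq ?_) h1
  rw [← Finset.sum_attach]
  refine Finset.sum_congr rfl fun g _ => ?_
  rw [ForestIndex.chainBound_ofGaps, Real.exp_sum]
  refine Finset.prod_congr rfl fun l _ => ?_
  rw [hy, ← Real.exp_nat_mul, show i - (l : ℕ) + (k - i - 1) = k - 1 - l by omega,
    show k - i - 1 = k - 1 - i by omega]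

/-- By the chain rule the entropy is the sum of the conditional entropies. The extremal inequality
is applied at its last index `k - 1`, where the conditional entropy is that of a single entry. -/
theorem tupleEntropy_le (hp : IsExchangeable k p) (a : ℕ) (hk : 1 ≤ k)
    (h : ∀ i, 1 ≤ i → i < k → ∀ (N : ℕ) (T : Finset (ForestIndex i N))
      (v : Fin (k - i - 1) → V) (w : ℕ → V), (open Classical in
      (T.filter fun τ => ChainGood p τ.IsThreshold w N (List.ofFn v)).card) ≤
        (a + i).choose i) :
    tupleEntropy p k ≤ k * tupleEntropy p 1 +
      ∑ j ∈ Finset.range k, Real.log (((a : ℝ) + j + 1) / (a + k)) := by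
  have hprod : ∀ i < k, ∀ M : ℕ, 1 ≤ M → ∏ j ∈ Finset.range i, ∑ g ∈ Finset.Icc 1 M,
      Real.exp (condEntropy p (k - 1 - j) - condEntropy p (k - 1 - i)) ^ g ≤
        ((a + i).choose i : ℝ) := by
    intro i hi M _
    rcases Nat.eq_zero_or_pos i with rfl | hi0
    · simp
    · exact hp.prod_exp_le i _ hi (h i hi0 hi) _ (fun j => rfl) M
  have hmain := sum_sub_le_of_prod_le_choose a k (fun j => condEntropy p (k - 1 - j))
    (fun i hi j hj => by
      have := lt_one_of_prod_sum_pow_le _ (fun j => Real.exp_pos _) _ (hprod i hi) j hj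
      rw [Real.exp_lt_one_iff] at this
      linarith)
    (fun i hi => prod_div_one_sub_le _ (fun j => Real.exp_pos _) _ (hprod i hi)) (k - 1)
    (by omega)
  obtain ⟨m, rfl⟩ : ∃ m, k = m + 1 := ⟨k - 1, by omega⟩
  simp only [Nat.add_sub_cancel, Nat.sub_self] at hmain
  have h0 : tupleEntropy p 0 = 0 := by simp [tupleEntropy, hp.nil]
  have htel : tupleEntropy p (m + 1) = ∑ j ∈ Finset.range (m + 1), condEntropy p (m - j) := by
    have h2 := Finset.sum_range_reflect (fun j => condEntropy p j) (m + 1)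
    simp only [Nat.add_sub_cancel] at h2
    rw [h2]
    simp only [condEntropy]
    rw [Finset.sum_range_sub, h0, sub_zero]
  have hc0 : condEntropy p 0 = tupleEntropy p 1 := by simp [condEntropy, h0]
  have hlog : ∀ j : ℕ, Real.log (((a : ℝ) + j + 1) / (a + (m + 1 : ℕ))) =
      Real.log (a + j + 1) - Real.log (a + m + 1) := fun j => by
    rw [Real.log_div (by positivity) (by positivity)]
    push_cast
    rw [add_assoc (a : ℝ) m 1]
  simp only [hlog]
  rw [Finset.sum_sub_distrib] at hmain
  rw [htel, Finset.sum_range_succ, Finset.sum_range_succ, Finset.sum_sub_distrib, Nat.sub_self,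
    hc0, Finset.sum_const, Finset.card_range, nsmul_eq_mul]
  rw [hc0] at hmain
  push_cast
  linarith

end IsExchangeable

/-! ### Turán numbers -/

namespace KGraph

variable {k : ℕ}

theorem card_edges_le {V : Type*} [Fintype V] (G : KGraph k V) :
    G.edges.card ≤ (Fintype.card V).choose k := by
  rw [← Finset.card_univ, ← Finset.card_powersetCard]
  exact Finset.card_le_card fun e he =>
    Finset.mem_powersetCard.2 ⟨Finset.subset_univ e, G.card_eq e he⟩

theorem isHom_iff {U V : Type*} [DecidableEq V] (F : KGraph k U) (G : KGraph k V) (f : U → V) :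
    IsHom F G f ↔ ∀ e ∈ F.edges, e.image f ∈ G.edges := by
  refine forall₂_congr fun e _ => ⟨?_, fun h => ⟨_, h, by simp⟩⟩
  rintro ⟨e', he', h⟩
  have : e' = e.image f := by rw [← Finset.coe_inj, h, Finset.coe_image]
  exact this ▸ he'

theorem IsHom.comp {U V W : Type*} {F : KGraph k U} {G : KGraph k V} {H : KGraph k W}
    {g : V → W} {f : U → V} (hg : IsHom G H g) (hf : IsHom F G f) : IsHom F H (g ∘ f) := by
  classical
  rw [isHom_iff] at *
  intro e he
  rw [← Finset.image_image]
  exact hg _ (hf e he)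

theorem IsHom.injOn {U V : Type*} {F : KGraph k U} {G : KGraph k V} {f : U → V}
    (hf : IsHom F G f) (e : Finset U) (he : e ∈ F.edges) : Set.InjOn f e := by
  classical
  rw [isHom_iff] at hf
  rw [← Finset.card_image_iff, G.card_eq _ (hf e he), F.card_eq e he]

open Classical in
/-- The pullback of a `k`-graph along a map. -/
noncomputable def comap {U V : Type*} [Fintype U] (f : U → V) (G : KGraph k V) :
    KGraph k U where
  edges := (Finset.univ.powersetCard k).filter fun e => e.image f ∈ G.edges
  card_eq _ he := (Finset.mem_powersetCard.1 (Finset.mem_filter.1 he).1).2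

theorem mem_comap {U V : Type*} [Fintype U] [DecidableEq V] (f : U → V) (G : KGraph k V)
    (e : Finset U) : e ∈ (comap f G).edges ↔ e.card = k ∧ e.image f ∈ G.edges := by
  simp only [comap, Finset.mem_filter, Finset.mem_powersetCard, Finset.subset_univ, true_and]
  congr!

theorem isHom_comap {U V : Type*} [Fintype U] (f : U → V) (G : KGraph k V) :
    IsHom (comap f G) G f := by
  classical
  rw [isHom_iff]
  intro e he
  exact ((mem_comap f G e).1 he).2

theorem IsFree.comap {U V : Type*} [Fintype U] {f : U → V} (hf : Function.Injective f)
    {G : KGraph k V} {𝓕 : Set (FinKGraph.{u} k)} (hG : G.IsFree 𝓕) : (comap f G).IsFree 𝓕 :=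
  fun F hF ⟨g, hg, h⟩ => hG F hF ⟨f ∘ g, hf.comp hg, (isHom_comap f G).comp h⟩

theorem bddAbove_card_free (n : ℕ) (𝓕 : Set (FinKGraph.{u} k)) :
    BddAbove {m : ℕ | ∃ G : KGraph k (Fin n), G.IsFree 𝓕 ∧ G.edges.card = m} := by
  refine ⟨n.choose k, ?_⟩
  rintro m ⟨G, -, rfl⟩
  simpa using G.card_edges_le

theorem IsFree.card_le_ex {n : ℕ} {𝓕 : Set (FinKGraph.{u} k)} {G : KGraph k (Fin n)}
    (hG : G.IsFree 𝓕) : G.edges.card ≤ ex n 𝓕 :=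
  le_csSup (bddAbove_card_free n 𝓕) ⟨G, hG, rfl⟩

theorem exists_card_eq_ex {n : ℕ} {𝓕 : Set (FinKGraph.{u} k)} (h : 0 < ex n 𝓕) :
    ∃ G : KGraph k (Fin n), G.IsFree 𝓕 ∧ G.edges.card = ex n 𝓕 := by
  refine Nat.sSup_mem (Set.nonempty_iff_ne_empty.2 fun h0 => ?_) (bddAbove_card_free n 𝓕)
  rw [ex, h0] at h
  simp at h

theorem card_filter_notMem_le {n : ℕ} (G : KGraph k (Fin (n + 1))) (v : Fin (n + 1)) :
    (G.edges.filter fun e => v ∉ e).card ≤ (comap v.succAbove G).edges.card := by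
  classical
  refine le_trans (Finset.card_le_card ?_)
    (Finset.card_image_le (s := (comap v.succAbove G).edges) (f := Finset.image v.succAbove))
  intro e he
  obtain ⟨he, hv⟩ := Finset.mem_filter.1 he
  have hpre : (e.preimage v.succAbove Fin.succAbove_right_injective.injOn).image v.succAbove
      = e := by
    rw [Finset.image_preimage]
    refine Finset.filter_true_of_mem fun x hx => ?_
    exact Fin.exists_succAbove_eq fun h => hv (h ▸ hx)
  refine Finset.mem_image.2 ⟨_, ?_, hpre⟩
  refine (mem_comap _ _ _).2 ⟨?_, ?_⟩
  · rw [← Finset.card_image_of_injective _ (Fin.succAbove_right_injective (p := v)), hpre,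
      G.card_eq e he]
  · rwa [hpre]

/-- Katona–Nemetz–Simonovits averaging: delete each vertex in turn; every edge survives `n + 1 - k`
of the deletions. -/
theorem ex_succ_mul_le (n : ℕ) (𝓕 : Set (FinKGraph.{u} k)) :
    ex (n + 1) 𝓕 * (n + 1 - k) ≤ (n + 1) * ex n 𝓕 := by
  classical
  rcases Nat.eq_zero_or_pos (ex (n + 1) 𝓕) with h | h
  · simp [h]
  obtain ⟨G, hG, hcard⟩ := exists_card_eq_ex h
  rw [← hcard]
  calc G.edges.card * (n + 1 - k)
      = ∑ e ∈ G.edges, ∑ v : Fin (n + 1), if v ∉ e then 1 else 0 := by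
        rw [Finset.sum_const_nat fun e he => ?_]
        rw [← Finset.card_filter, ← Finset.compl_filter, Finset.card_compl,
          Finset.filter_mem_eq_inter, Finset.univ_inter, G.card_eq e he, Fintype.card_fin]
    _ = ∑ v : Fin (n + 1), (G.edges.filter fun e => v ∉ e).card := by
        rw [Finset.sum_comm]
        exact Finset.sum_congr rfl fun v _ => (Finset.card_filter _ _).symm
    _ ≤ ∑ _v : Fin (n + 1), ex n 𝓕 := Finset.sum_le_sum fun v _ =>
        (card_filter_notMem_le G v).trans
          (hG.comap Fin.succAbove_right_injective).card_le_ex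
    _ = (n + 1) * ex n 𝓕 := by simp

theorem turanRatio_succ_le (𝓕 : Set (FinKGraph.{u} k)) (n : ℕ) (hn : k ≤ n) :
    turanRatio 𝓕 (n + 1) ≤ turanRatio 𝓕 n := by
  have h1 := ex_succ_mul_le n 𝓕
  have h2 := Nat.choose_mul_succ_eq n k
  have h3 : 0 < n.choose k := Nat.choose_pos hn
  have h4 : 0 < (n + 1).choose k := Nat.choose_pos (by omega)
  have h5 : 0 < n + 1 - k := by omega
  rw [turanRatio, turanRatio, div_le_div_iff₀ (by exact_mod_cast h4) (by exact_mod_cast h3)]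
  norm_cast
  refine Nat.le_of_mul_le_mul_right (c := n + 1 - k) ?_ h5
  calc ex (n + 1) 𝓕 * n.choose k * (n + 1 - k)
      = ex (n + 1) 𝓕 * (n + 1 - k) * n.choose k := by ring
    _ ≤ (n + 1) * ex n 𝓕 * n.choose k := Nat.mul_le_mul_right _ h1
    _ = ex n 𝓕 * (n.choose k * (n + 1)) := by ring
    _ = ex n 𝓕 * (n + 1).choose k * (n + 1 - k) := by rw [h2]; ring

theorem turanRatio_antitone (𝓕 : Set (FinKGraph.{u} k)) :
    Antitone fun n => turanRatio 𝓕 (n + k) :=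
  antitone_nat_of_succ_le fun n => by
    rw [show n + 1 + k = n + k + 1 by omega]
    exact turanRatio_succ_le 𝓕 _ (by omega)

theorem turanRatio_nonneg (𝓕 : Set (FinKGraph.{u} k)) (n : ℕ) : 0 ≤ turanRatio 𝓕 n := by
  unfold turanRatio
  positivity

theorem tendsto_turanRatio (𝓕 : Set (FinKGraph.{u} k)) :
    Tendsto (turanRatio 𝓕) atTop (𝓝 (turanDensity 𝓕)) := by
  have h := tendsto_atTop_ciInf (turanRatio_antitone 𝓕)
    ⟨0, by rintro _ ⟨n, rfl⟩; exact turanRatio_nonneg 𝓕 _⟩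
  have h' := (tendsto_add_atTop_iff_nat (f := turanRatio 𝓕) k).1 h
  exact tendsto_nhds_limUnder ⟨_, h'⟩

theorem turanDensity_le_turanRatio (𝓕 : Set (FinKGraph.{u} k)) (n : ℕ) (hn : k ≤ n) :
    turanDensity 𝓕 ≤ turanRatio 𝓕 n := by
  have h := (turanRatio_antitone 𝓕).le_of_tendsto
    ((tendsto_add_atTop_iff_nat k).2 (tendsto_turanRatio 𝓕)) (n - k)
  simpa [Nat.sub_add_cancel hn] using h

end KGraph

/-! ### Counting blowups -/

theorem card_mul_mean_pow_le {ι : Type*} (s : Finset ι) (f : ι → ℝ) (hf : ∀ i ∈ s, 0 ≤ f i)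
    (e : ℕ) (he : e ≠ 0) (c : ℝ) (hc : 0 ≤ c) (h : s.card * c ≤ ∑ i ∈ s, f i) :
    s.card * c ^ e ≤ ∑ i ∈ s, f i ^ e := by
  obtain ⟨n, rfl⟩ := Nat.exists_eq_succ_of_ne_zero he
  refine le_trans ?_ (pow_sum_div_card_le_sum_pow hf n)
  rcases Nat.eq_zero_or_pos s.card with h0 | h0
  · simp only [h0, Nat.cast_zero, zero_mul] at h ⊢
    have := Finset.sum_nonneg hf
    positivity
  · have h0' : (0 : ℝ) < s.card := by exact_mod_cast h0
    rw [le_div_iff₀ (by positivity)]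
    calc (s.card : ℝ) * c ^ (n + 1) * s.card ^ n = (s.card * c) ^ (n + 1) := by ring
      _ ≤ _ := pow_le_pow_left₀ (by positivity) h _

open Classical in
/-- Among the maps `ψ : Fin s → Fin (m + 1) → V`, many have all their sections in a dense set
`A` of maps `Fin s → V`. -/
theorem card_blowup_ge {V : Type*} [Fintype V] (m s : ℕ) (A : Finset (Fin s → V)) (δ : ℝ)
    (hδ : 0 ≤ δ) (hA : δ * (Fintype.card V : ℝ) ^ s ≤ A.card) :
    δ ^ ((m + 1) ^ s) * (Fintype.card V : ℝ) ^ ((m + 1) * s) ≤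
      ((Finset.univ.filter fun ψ : Fin s → Fin (m + 1) → V =>
        ∀ c : Fin s → Fin (m + 1), (fun i => ψ i (c i)) ∈ A).card : ℝ) := by
  induction s generalizing δ with
  | zero =>
    simp only [pow_zero, mul_zero, pow_one, mul_one] at hA ⊢
    refine hA.trans ?_
    norm_cast
    rcases A.eq_empty_or_nonempty with rfl | ⟨x, hx⟩
    · simp
    · have h1 : A.card ≤ 1 := (Finset.card_le_univ A).trans (by simp)
      refine h1.trans (Finset.card_pos.2 ⟨fun i => i.elim0, ?_⟩)
      rw [Finset.mem_filter]
      exact ⟨Finset.mem_univ _, fun c => by convert hx⟩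
  | succ s ih =>
    set n : ℝ := (Fintype.card V : ℝ) with hn
    -- Only the first coordinate is replicated at this stage: `Ax x` collects the tails compatible
    -- with all copies in `x`. Double counting and the power mean inequality bound its average size
    -- below. The induction hypothesis then applies to each `Ax x` with its own density, and a
    -- second power mean inequality averages over `x`.
    set Ax : (Fin (m + 1) → V) → Finset (Fin s → V) := fun x =>
      Finset.univ.filter fun y => ∀ j, (Fin.cons (x j) y : Fin (s + 1) → V) ∈ A with hAx
    set D : (Fin s → V) → Finset V := fun y =>
      Finset.univ.filter fun z => (Fin.cons z y : Fin (s + 1) → V) ∈ A with hD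
    have hsplit : (((Finset.univ.filter fun ψ : Fin (s + 1) → Fin (m + 1) → V =>
        ∀ c : Fin (s + 1) → Fin (m + 1), (fun i => ψ i (c i)) ∈ A).card : ℕ) : ℝ) =
        ∑ x : Fin (m + 1) → V, ((Finset.univ.filter fun ψ : Fin s → Fin (m + 1) → V =>
          ∀ c : Fin s → Fin (m + 1), (fun i => ψ i (c i)) ∈ Ax x).card : ℝ) := by
      simp only [Finset.card_filter]
      push_cast
      rw [← (Fin.consEquiv fun _ => Fin (m + 1) → V).sum_comp, Fintype.sum_prod_type]
      refine Finset.sum_congr rfl fun x _ => Finset.sum_congr rfl fun ψ _ => ?_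
      refine if_congr ?_ rfl rfl
      simp only [hAx, Finset.mem_filter, Finset.mem_univ, true_and, Fin.consEquiv,
        Equiv.coe_fn_mk]
      constructor
      · intro h c j
        convert h (Fin.cons j c) using 1
        funext i
        refine Fin.cases ?_ (fun i => ?_) i <;> simp
      · intro h c
        convert h (fun i => c i.succ) (c 0) using 1
        funext i
        refine Fin.cases ?_ (fun i => ?_) i <;> simp
    have hAcard : (A.card : ℝ) = ∑ y : Fin s → V, ((D y).card : ℝ) := by
      rw [← Finset.filter_univ_mem A]
      simp only [hD, Finset.card_filter]
      push_cast
      rw [← (Fin.consEquiv fun _ => V).sum_comp, Fintype.sum_prod_type, Finset.sum_comm]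
      rfl
    have hAxcard : ∑ x, ((Ax x).card : ℝ) = ∑ y : Fin s → V, ((D y).card : ℝ) ^ (m + 1) := by
      have : ∀ y, ((D y).card : ℝ) ^ (m + 1) = ((Finset.univ.filter fun x : Fin (m + 1) → V =>
          ∀ j, (Fin.cons (x j) y : Fin (s + 1) → V) ∈ A).card : ℝ) := fun y => by
        have h := Fintype.card_piFinset_const (D y) (m + 1)
        norm_cast
        rw [← h]
        congr 1
        ext x
        simp [hD]
      simp only [this, hAx, Finset.card_filter]
      push_cast
      rw [Finset.sum_comm]
    have hcs : ((Finset.univ : Finset (Fin s → V)).card : ℝ) = n ^ s := by simp [hn]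
    have hcm : ((Finset.univ : Finset (Fin (m + 1) → V)).card : ℝ) = n ^ (m + 1) := by
      simp [hn]
    have hn0 : 0 ≤ n := Nat.cast_nonneg _
    have h1 : n ^ s * (δ * n) ^ (m + 1) ≤ ∑ x, ((Ax x).card : ℝ) := by
      rw [hAxcard, ← hcs]
      refine card_mul_mean_pow_le _ _ (fun _ _ => Nat.cast_nonneg _) _ (by omega) _
        (by positivity) ?_
      rw [hcs, ← hAcard]
      refine le_trans (le_of_eq ?_) hA
      ring
    rcases hn0.eq_or_lt with h0 | h0
    · rw [← h0, zero_pow (by positivity), mul_zero]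
      positivity
    have h2 : n ^ (m + 1) * δ ^ (m + 1) ≤ ∑ x, ((Ax x).card : ℝ) / n ^ s := by
      rw [← Finset.sum_div, le_div_iff₀ (by positivity)]
      refine le_trans (le_of_eq ?_) h1
      ring
    have h3 := card_mul_mean_pow_le Finset.univ (fun x => ((Ax x).card : ℝ) / n ^ s)
      (fun _ _ => by positivity) ((m + 1) ^ s) (by positivity) (δ ^ (m + 1)) (by positivity)
      (by rw [hcm]; exact h2)
    rw [hsplit]
    calc δ ^ ((m + 1) ^ (s + 1)) * n ^ ((m + 1) * (s + 1))
        = n ^ (m + 1) * (δ ^ (m + 1)) ^ ((m + 1) ^ s) * n ^ ((m + 1) * s) := by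
          rw [← pow_mul]; ring
      _ ≤ (∑ x, (((Ax x).card : ℝ) / n ^ s) ^ ((m + 1) ^ s)) * n ^ ((m + 1) * s) := by
          rw [hcm] at h3
          exact mul_le_mul_of_nonneg_right h3 (by positivity)
      _ ≤ _ := by
          rw [Finset.sum_mul]
          refine Finset.sum_le_sum fun x _ => ih (Ax x) _ (by positivity) ?_
          rw [div_mul_cancel₀ _ (by positivity)]

theorem tendsto_descFactorial_div_pow (k : ℕ) :
    Tendsto (fun n : ℕ => (n.descFactorial k : ℝ) / (n : ℝ) ^ k) atTop (𝓝 1) := by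
  refine (Asymptotics.isEquivalent_iff_tendsto_one ?_).1 (isEquivalent_descFactorial k)
  filter_upwards [eventually_gt_atTop 0] with n hn
  positivity

open Classical in
/-- A dense set of maps `Fin s → Fin n` contains all sections of an injective map on
`Fin s × Fin (m + 1)`. -/
theorem exists_injective_blowup (m s : ℕ) (δ : ℝ) (hδ : 0 < δ) :
    ∀ᶠ n : ℕ in atTop, ∀ A : Finset (Fin s → Fin n), δ * (n : ℝ) ^ s ≤ A.card →
      ∃ ψ : Fin s × Fin (m + 1) → Fin n, Function.Injective ψ ∧
        ∀ c : Fin s → Fin (m + 1), (fun i => ψ (i, c i)) ∈ A := by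
  have h := (tendsto_descFactorial_div_pow (s * (m + 1))).eventually_const_lt
    (show 1 - δ ^ ((m + 1) ^ s) < 1 by have : 0 < δ ^ ((m + 1) ^ s) := by positivity
                                       linarith)
  filter_upwards [h, eventually_gt_atTop 0] with n hn hn0 A hA
  have hn0' : (0 : ℝ) < n := by exact_mod_cast hn0
  rw [lt_div_iff₀ (by positivity)] at hn
  have h1 := card_blowup_ge m s A δ hδ.le (by simpa using hA)
  set I := Finset.univ.filter fun ψ : Fin s × Fin (m + 1) → Fin n => Function.Injective ψ
  set J := Finset.univ.filter fun ψ : Fin s × Fin (m + 1) → Fin n =>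
    ∀ c : Fin s → Fin (m + 1), (fun i => ψ (i, c i)) ∈ A
  have hI : I.card = n.descFactorial (s * (m + 1)) := by
    have := Fintype.card_embedding_eq (α := Fin s × Fin (m + 1)) (β := Fin n)
    rw [Fintype.card_congr (Equiv.subtypeInjectiveEquivEmbedding _ _).symm,
      Fintype.card_subtype] at this
    simpa using this
  have h2 : δ ^ ((m + 1) ^ s) * (n : ℝ) ^ (s * (m + 1)) ≤ J.card := by
    rw [Fintype.card_fin, mul_comm (m + 1) s] at h1
    refine h1.trans_eq (congrArg _ (Finset.card_equiv (Equiv.curry _ _ _).symm fun ψ => ?_))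
    simp [J]
  -- Injective maps have proportion tending to 1, so for large `n` they and the maps in `J` together
  -- outnumber all maps and must intersect.
  have hlt : (Finset.univ : Finset (Fin s × Fin (m + 1) → Fin n)).card < I.card + J.card := by
    have hc : (Finset.univ : Finset (Fin s × Fin (m + 1) → Fin n)).card = n ^ (s * (m + 1)) := by
      simp
    rw [hc, hI]
    have : ((n ^ (s * (m + 1)) : ℕ) : ℝ) < n.descFactorial (s * (m + 1)) + (J.card : ℝ) := by
      push_cast
      linarith
    exact_mod_cast this
  obtain ⟨ψ, hψ⟩ := Finset.inter_nonempty_of_card_lt_card_add_card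
    (Finset.subset_univ I) (Finset.subset_univ J) hlt
  rw [Finset.mem_inter, Finset.mem_filter, Finset.mem_filter] at hψ
  exact ⟨ψ, hψ.1.2, hψ.2.2⟩

/-! ### Sampling -/

/-- Choose a bijection from `e` to `E`, and arbitrary values off `e`. -/
theorem card_filter_image_eq_ge {ι V : Type*} [Fintype ι] [Fintype V] [DecidableEq ι]
    [DecidableEq V] (e : Finset ι)
    (E : Finset V) (h : e.card = E.card) :
    e.card.factorial * Fintype.card V ^ (Fintype.card ι - e.card) ≤
      (Finset.univ.filter fun φ : ι → V => e.image φ = E).card := by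
  have σ₀ : e ≃ E := Finset.equivOfCardEq h
  have h1 : e.card.factorial * Fintype.card V ^ (Fintype.card ι - e.card) =
      Fintype.card ((e ≃ E) × ({x // x ∉ e} → V)) := by
    rw [Fintype.card_prod, Fintype.card_equiv σ₀, Fintype.card_fun, Fintype.card_coe,
      Fintype.card_subtype_compl, Fintype.card_coe]
  rw [h1, ← Finset.card_univ]
  refine Finset.card_le_card_of_injOn
    (fun x i => if hi : i ∈ e then (x.1 ⟨i, hi⟩ : V) else x.2 ⟨i, hi⟩) ?_ ?_
  · rintro ⟨σ, f⟩ -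
    simp only [Finset.coe_filter, Finset.mem_univ, true_and, Set.mem_ofPred_eq]
    ext v
    simp only [Finset.mem_image]
    constructor
    · rintro ⟨i, hi, rfl⟩
      rw [dif_pos hi]
      exact (σ ⟨i, hi⟩).2
    · intro hv
      refine ⟨σ.symm ⟨v, hv⟩, (σ.symm ⟨v, hv⟩).2, ?_⟩
      simp
  · rintro ⟨σ, f⟩ - ⟨σ', f'⟩ - hx
    simp only [Prod.mk.injEq]
    constructor
    · ext i
      have := congrFun hx i
      simpa using this
    · funext i
      have := congrFun hx i
      simpa [i.2] using this

namespace KGraph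

variable {k : ℕ}

theorem sum_card_comap_ge {s n : ℕ} (G : KGraph k (Fin n)) :
    s.choose k * (G.edges.card * (k.factorial * n ^ (s - k))) ≤
      ∑ φ : Fin s → Fin n, (comap φ G).edges.card := by
  classical
  have h1 : ∀ φ : Fin s → Fin n, (comap φ G).edges.card =
      ∑ e ∈ (Finset.univ : Finset (Fin s)).powersetCard k,
        if e.image φ ∈ G.edges then 1 else 0 := fun φ => by
    rw [← Finset.card_filter, comap]
    congr!
  simp only [h1]
  rw [Finset.sum_comm]
  have h2 := Finset.card_nsmul_le_sum ((Finset.univ : Finset (Fin s)).powersetCard k)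
    (fun e => ∑ φ : Fin s → Fin n, if e.image φ ∈ G.edges then 1 else 0)
    (G.edges.card * (k.factorial * n ^ (s - k))) ?_
  · simpa using h2
  · intro e he
    have hek := (Finset.mem_powersetCard.1 he).2
    rw [← Finset.card_filter, Finset.card_eq_sum_card_fiberwise
      (s := Finset.univ.filter fun φ : Fin s → Fin n => e.image φ ∈ G.edges)
      (f := fun φ => e.image φ) (t := G.edges) fun φ hφ => (Finset.mem_filter.1 hφ).2]
    have h3 := Finset.card_nsmul_le_sum G.edges
      (fun E => ((Finset.univ.filter fun φ : Fin s → Fin n => e.image φ ∈ G.edges).filter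
        fun φ => e.image φ = E).card) (k.factorial * n ^ (s - k)) fun E hE => by
      have h4 := card_filter_image_eq_ge e E (hek.trans (G.card_eq E hE).symm)
      rw [hek, Fintype.card_fin, Fintype.card_fin] at h4
      refine h4.trans (Finset.card_le_card fun φ hφ => ?_)
      have := (Finset.mem_filter.1 hφ).2
      simp only [Finset.mem_filter, Finset.mem_univ, true_and]
      exact ⟨by rwa [this], this⟩
    simpa using h3

open Classical in
/-- A `k`-graph that receives a homomorphism from a member of `𝓕` has few homomorphisms to
`𝓕`-free `k`-graphs. -/
theorem card_hom_le {s : ℕ} (𝓕 : Set (FinKGraph.{u} k)) (Q : KGraph k (Fin s))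
    (hQ : ¬ Q.IsHomFree 𝓕) (δ : ℝ) (hδ : 0 < δ) :
    ∀ᶠ n : ℕ in atTop, ∀ G : KGraph k (Fin n), G.IsFree 𝓕 →
      ((Finset.univ.filter fun φ : Fin s → Fin n => IsHom Q G φ).card : ℝ) ≤ δ * n ^ s := by
  simp only [IsHomFree, not_forall, not_not] at hQ
  obtain ⟨F, hF, f, hf⟩ := hQ
  have := F.finite
  filter_upwards [exists_injective_blowup (Nat.card F.V) s δ hδ] with n hn G hG
  by_contra! hcon
  obtain ⟨ψ, hψ, hsec⟩ := hn _ hcon.le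
  -- Distinct vertices of `F` get distinct copy indices, so `f` lifts to an injective map into the
  -- blowup even where `f` identifies vertices.
  set idx : F.V → Fin (Nat.card F.V + 1) := fun x => (Finite.equivFin F.V x).castSucc with hidx
  have hidx_inj : Function.Injective idx :=
    (Fin.castSucc_injective _).comp (Finite.equivFin F.V).injective
  refine hG F hF ⟨fun x => ψ (f x, idx x), fun x y hxy => ?_, ?_⟩
  · exact hidx_inj (Prod.ext_iff.1 (hψ hxy)).2
  · rw [isHom_iff]
    intro e he
    have hinj := hf.injOn e he
    -- The section through the lifted edge `e`; it is consistent since `f` is injective on `e`. Off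
    -- the image of `e` the value 0 is arbitrary.
    set c : Fin s → Fin (Nat.card F.V + 1) := fun i =>
      if h : ∃ x ∈ e, f x = i then idx h.choose else 0 with hc
    have hcx : ∀ x ∈ e, c (f x) = idx x := fun x hx => by
      have h : ∃ y ∈ e, f y = f x := ⟨x, hx, rfl⟩
      rw [hc]
      simp only
      rw [dif_pos h, hinj h.choose_spec.1 hx h.choose_spec.2]
    have h1 := (isHom_iff _ _ _).1 (Finset.mem_filter.1 (hsec c)).2 _ ((isHom_iff _ _ _).1 hf e he)
    rw [Finset.image_image] at h1
    convert h1 using 1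
    refine Finset.image_congr fun x hx => ?_
    simp [hcx x hx]

instance {V : Type*} [Finite V] : Finite (KGraph k V) :=
  Finite.of_injective (fun G => G.edges) fun G H h => by
    cases G; cases H; congr

/-- There are `𝓕`-hom-free `k`-graphs of density close to the Turán density, on any number of
vertices. -/
theorem exists_isHomFree (𝓕 : Set (FinKGraph.{u} k)) (s : ℕ) (hs : k ≤ s) (ε : ℝ) (hε : 0 < ε)
    (hεπ : ε < turanDensity 𝓕) :
    ∃ G : KGraph k (Fin s), G.IsHomFree 𝓕 ∧
      (turanDensity 𝓕 - ε) * (s.choose k : ℝ) ≤ G.edges.card := by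
  classical
  by_contra! hcon
  have : Fintype (KGraph k (Fin s)) := Fintype.ofFinite _
  set π := turanDensity 𝓕 with hπ
  set Bad := (Finset.univ : Finset (KGraph k (Fin s))).filter fun Q => ¬ Q.IsHomFree 𝓕 with hBad
  -- Chosen so that the samples inducing any bad graph number at most (ε/2)n^s in total.
  set δ : ℝ := ε / (2 * (Bad.card + 1)) with hδ
  have hδ0 : 0 < δ := by positivity
  have h1 : ∀ᶠ n : ℕ in atTop, ∀ Q ∈ Bad, ∀ G : KGraph k (Fin n), G.IsFree 𝓕 →
      ((Finset.univ.filter fun φ : Fin s → Fin n => IsHom Q G φ).card : ℝ) ≤ δ * n ^ s :=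
    (eventually_all_finset Bad).2 fun Q hQ => card_hom_le 𝓕 Q (Finset.mem_filter.1 hQ).2 δ hδ0
  have h2 : ∀ᶠ n : ℕ in atTop, π - ε / 2 < π * ((n.descFactorial k : ℝ) / (n : ℝ) ^ k) :=
    ((tendsto_descFactorial_div_pow k).const_mul π).eventually_const_lt (by linarith)
  obtain ⟨n, hn1, hn2, hnk, hn0⟩ := (h1.and (h2.and ((eventually_ge_atTop k).and
    (eventually_gt_atTop 0)))).exists
  have hn0' : (0 : ℝ) < n := by exact_mod_cast hn0
  have hratio := turanDensity_le_turanRatio 𝓕 n hnk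
  have hck : (0 : ℝ) < n.choose k := by exact_mod_cast Nat.choose_pos hnk
  have hcs : (0 : ℝ) < s.choose k := by exact_mod_cast Nat.choose_pos hs
  rw [turanRatio, le_div_iff₀ hck] at hratio
  have hex : 0 < ex n 𝓕 := by
    have : (0 : ℝ) < ex n 𝓕 := lt_of_lt_of_le (mul_pos (hε.trans hεπ) hck) hratio
    exact_mod_cast this
  obtain ⟨G, hG, hGcard⟩ := exists_card_eq_ex hex
  rw [← hGcard] at hratio
  have hlow := sum_card_comap_ge (s := s) G
  have hbad : ((Finset.univ.filter fun φ : Fin s → Fin n =>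
      ¬ (comap φ G).IsHomFree 𝓕).card : ℝ) ≤ ε / 2 * n ^ s := by
    have h3 := Finset.card_eq_sum_card_fiberwise (f := fun φ : Fin s → Fin n => comap φ G)
      (s := Finset.univ.filter fun φ : Fin s → Fin n => ¬ (comap φ G).IsHomFree 𝓕) (t := Bad)
      fun φ hφ => by simpa [hBad] using hφ
    rw [h3]
    push_cast
    calc _ ≤ ∑ _Q ∈ Bad, δ * (n : ℝ) ^ s := by
          refine Finset.sum_le_sum fun Q hQ => le_trans ?_ (hn1 Q hQ G hG)
          norm_cast
          refine Finset.card_le_card fun φ hφ => ?_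
          have h4 := (Finset.mem_filter.1 hφ).2
          exact Finset.mem_filter.2 ⟨Finset.mem_univ _, h4 ▸ isHom_comap φ G⟩
      _ = Bad.card * δ * n ^ s := by rw [Finset.sum_const, nsmul_eq_mul]; ring
      _ ≤ ε / 2 * n ^ s := by
          refine mul_le_mul_of_nonneg_right ?_ (by positivity)
          rw [hδ, mul_div_assoc', div_le_div_iff₀ (by positivity) (by positivity)]
          nlinarith
  -- A hom-free sample has fewer than (π - ε)C(s, k) edges by `hcon`, and a bad one at most C(s, k).
  -- The resulting average contradicts the lower bound from `sum_card_comap_ge`.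
  have hup : (∑ φ : Fin s → Fin n, ((comap φ G).edges.card : ℝ)) ≤
      (π - ε / 2) * n ^ s * s.choose k := by
    calc _ ≤ ∑ φ : Fin s → Fin n, ((π - ε) * s.choose k +
          if ¬ (comap φ G).IsHomFree 𝓕 then (s.choose k : ℝ) else 0) := by
          refine Finset.sum_le_sum fun φ _ => ?_
          by_cases h : (comap φ G).IsHomFree 𝓕
          · simpa [h] using (hcon _ h).le
          · have h5 : ((comap φ G).edges.card : ℝ) ≤ s.choose k := by
              exact_mod_cast (comap φ G).card_edges_le.trans (by simp)
            have h6 : 0 ≤ (π - ε) * s.choose k := mul_nonneg (by linarith) hcs.le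
            simp only [h, not_false_eq_true, if_true]
            linarith
      _ = n ^ s * ((π - ε) * s.choose k) + ((Finset.univ.filter fun φ : Fin s → Fin n =>
          ¬ (comap φ G).IsHomFree 𝓕).card : ℝ) * s.choose k := by
          rw [Finset.sum_add_distrib, Finset.sum_const, ← Finset.sum_filter, Finset.sum_const]
          simp
      _ ≤ n ^ s * ((π - ε) * s.choose k) + ε / 2 * n ^ s * s.choose k := by gcongr
      _ = _ := by ring
  have hlow' : (s.choose k : ℝ) * (G.edges.card * (k.factorial * n ^ (s - k))) ≤
      ∑ φ : Fin s → Fin n, ((comap φ G).edges.card : ℝ) := by exact_mod_cast hlow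
  have h7 : (s.choose k : ℝ) * (π * n.choose k * (k.factorial * n ^ (s - k))) ≤
      (π - ε / 2) * n ^ s * s.choose k :=
    le_trans (by gcongr) (hlow'.trans hup)
  have h8 : π * ((n.choose k : ℝ) * k.factorial) * n ^ (s - k) ≤
      (π - ε / 2) * n ^ k * n ^ (s - k) := by
    refine le_of_mul_le_mul_left ?_ hcs
    have h9 : (n : ℝ) ^ s = n ^ k * n ^ (s - k) := by rw [← pow_add, Nat.add_sub_cancel' hs]
    rw [h9] at h7
    linarith
  have h10 := le_of_mul_le_mul_right h8 (by positivity)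
  rw [mul_div_assoc', lt_div_iff₀ (by positivity), Nat.descFactorial_eq_factorial_mul_choose]
    at hn2
  push_cast at hn2
  linarith

end KGraph

/-! ### The law of a random ordered edge -/

namespace KGraph

variable {k : ℕ} {V : Type*} [DecidableEq V]

/-- The probability that a uniformly random ordered edge starts with `u`. -/
noncomputable def edgeLaw (G : KGraph k V) (u : List V) : ℝ :=
  if u.Nodup then ((k - u.length).factorial : ℝ) *
    ((G.edges.filter fun e => u.toFinset ⊆ e).card : ℝ) / (k.factorial * G.edges.card) else 0

theorem edgeLaw_pos {G : KGraph k V} {u : List V} (h : 0 < G.edgeLaw u) :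
    u.Nodup ∧ ∃ e ∈ G.edges, ∀ x ∈ u, x ∈ e := by
  unfold edgeLaw at h
  split_ifs at h with hu
  · refine ⟨hu, ?_⟩
    by_contra! hcon
    rw [Finset.filter_false_of_mem fun e he => fun hs =>
      let ⟨x, hx, hxe⟩ := hcon e he
      hxe (hs (List.mem_toFinset.2 hx))] at h
    simp at h
  · exact absurd h (lt_irrefl _)

theorem edgeLaw_isExchangeable [Fintype V] (G : KGraph k V) (hG : G.edges.Nonempty) :
    IsExchangeable k G.edgeLaw where
  nonneg u := by
    unfold edgeLaw
    split_ifs <;> positivity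
  perm u v h := by
    unfold edgeLaw
    rw [List.toFinset_eq_of_perm _ _ h, h.length_eq]
    simp only [h.nodup_iff]
  nil := by
    have : (0 : ℝ) < G.edges.card := by exact_mod_cast hG.card_pos
    have hk : (0 : ℝ) < k.factorial := by exact_mod_cast k.factorial_pos
    simp only [edgeLaw, List.nodup_nil, if_true, List.length_nil, Nat.sub_zero,
      List.toFinset_nil, Finset.empty_subset, Finset.filter_true]
    exact div_self (by positivity)
  sum_cons u hu := by
    by_cases hn : u.Nodup
    · have h1 : ∀ x, G.edgeLaw (x :: u) = ((k - (u.length + 1)).factorial : ℝ) /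
          (k.factorial * G.edges.card) * ∑ e ∈ G.edges.filter fun e => u.toFinset ⊆ e,
            if x ∈ e \ u.toFinset then 1 else 0 := fun x => by
        unfold edgeLaw
        by_cases hx : x ∈ u
        · rw [if_neg (by simp [hx]), Finset.sum_eq_zero fun e _ => by simp [hx], mul_zero]
        · rw [if_pos (by simp [hx, hn]), Finset.sum_boole, Finset.filter_filter,
            List.length_cons, mul_div_right_comm]
          congr 3
          refine Finset.filter_congr fun e _ => ?_
          simp [hx, Finset.insert_subset_iff, and_comm]
      simp only [h1]
      rw [← Finset.mul_sum, Finset.sum_comm]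
      have h2 : ∀ e ∈ G.edges.filter fun e => u.toFinset ⊆ e,
          ∑ x : V, (if x ∈ e \ u.toFinset then (1 : ℝ) else 0) = ((k - u.length : ℕ) : ℝ) := by
        intro e he
        obtain ⟨he, hue⟩ := Finset.mem_filter.1 he
        rw [Finset.sum_boole, Finset.filter_univ_mem, Finset.card_sdiff_of_subset hue, G.card_eq e he,
          List.toFinset_card_of_nodup hn]
      rw [Finset.sum_congr rfl h2, Finset.sum_const, nsmul_eq_mul, edgeLaw, if_pos hn,
        show k - u.length = (k - (u.length + 1)) + 1 by omega, Nat.factorial_succ]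
      push_cast
      ring
    · have h1 : ∀ x, G.edgeLaw (x :: u) = 0 := fun x => by
        unfold edgeLaw
        rw [if_neg (by simp [hn])]
      simp only [h1, Finset.sum_const_zero]
      rw [edgeLaw, if_neg hn]

/-- The law is uniform on the k!|E| ordered edges. Only the upper bound 1/(k!|E|) on each atom is
needed, and it holds because `k` distinct vertices lie in at most one edge. -/
theorem log_le_tupleEntropy_edgeLaw [Fintype V] (G : KGraph k V) (hG : G.edges.Nonempty) :
    Real.log (k.factorial * G.edges.card) ≤ tupleEntropy G.edgeLaw k := by
  have hp := G.edgeLaw_isExchangeable hG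
  have hE : (0 : ℝ) < G.edges.card := by exact_mod_cast hG.card_pos
  have hk : (0 : ℝ) < k.factorial := by exact_mod_cast k.factorial_pos
  rw [← one_mul (Real.log _), ← hp.sum_eq_one k le_rfl, Finset.sum_mul, tupleEntropy]
  refine Finset.sum_le_sum fun u _ => ?_
  rcases (hp.nonneg (List.ofFn u)).eq_or_lt with h0 | h0
  · simp [← h0]
  rw [Real.negMulLog, neg_mul, ← mul_neg, ← Real.log_inv]
  refine mul_le_mul_of_nonneg_left (Real.log_le_log (by positivity) ?_) h0.le
  rw [le_inv_comm₀ (by positivity) h0]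
  have hn := (edgeLaw_pos h0).1
  rw [edgeLaw, if_pos hn, List.length_ofFn, Nat.sub_self, Nat.factorial_zero, Nat.cast_one,
    one_mul, ← one_div]
  refine div_le_div_of_nonneg_right ?_ (by positivity)
  norm_cast
  rw [Finset.card_le_one]
  have heq : ∀ e ∈ G.edges.filter fun e => (List.ofFn u).toFinset ⊆ e,
      (List.ofFn u).toFinset = e := fun e he => by
    obtain ⟨he, hue⟩ := Finset.mem_filter.1 he
    refine Finset.eq_of_subset_of_card_le hue ?_
    rw [G.card_eq e he, List.toFinset_card_of_nodup hn, List.length_ofFn]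
  exact fun e he e' he' => (heq e he).symm.trans (heq e' he')

end KGraph

theorem IsExchangeable.tupleEntropy_one_le {V : Type*} [Fintype V] {k : ℕ} {p : List V → ℝ}
    (hp : IsExchangeable k p) (hk : 1 ≤ k) : tupleEntropy p 1 ≤ Real.log (Fintype.card V) := by
  have hV : 0 < Fintype.card V := by
    rw [Fintype.card_pos_iff]
    by_contra hV
    rw [not_nonempty_iff] at hV
    have := hp.sum_cons [] (by simp; omega)
    rw [hp.nil] at this
    simp at this
  have := sum_mul_log_le_log Finset.univ (fun u : Fin 1 → V => p (List.ofFn u))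
    (fun u => (p (List.ofFn u))⁻¹) (Fintype.card V) (by exact_mod_cast hV)
    (fun u _ => hp.nonneg _) (hp.sum_eq_one 1 hk) (fun u _ h => inv_pos.2 h) (by
      refine (Finset.sum_le_card_nsmul _ _ 1 fun u _ => ?_).trans (by simp)
      exact mul_inv_le_one)
  simpa [tupleEntropy, Real.negMulLog, Real.log_inv] using this

/-! ### Homomorphisms from extensions -/

/-- The new vertices of a maximal face are sent bijectively onto the part of its edge `E` not
covered by `φ`. Different maximal faces share no new vertices, so these choices are independent. -/
theorem PartialKGraph.exists_isHom_extension {k : ℕ} {W V : Type*} [Finite W]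
    (P : PartialKGraph k W) (G : KGraph k V) (φ : W → V)
    (h : ∀ e ∈ P.faces, Set.InjOn φ e ∧ ∃ E ∈ G.edges, ∀ x ∈ e, φ x ∈ E) :
    ∃ f, KGraph.IsHom P.extension G f := by
  classical
  choose hinj E hE hsub using fun e : P.MaxFace => h e.1 e.2.1
  have hcard : ∀ e : P.MaxFace, (E e \ e.1.image φ).card = k - e.1.card := fun e => by
    rw [Finset.card_sdiff_of_subset (Finset.image_subset_iff.2 (hsub e)), G.card_eq _ (hE e),
      Finset.card_image_of_injOn (hinj e)]
  let ρ := fun e => (Finset.equivFinOfCardEq (hcard e)).symm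
  refine ⟨Sum.elim φ fun x => (ρ x.1 x.2 : V), ?_⟩
  rw [KGraph.isHom_iff]
  intro e' he'
  obtain ⟨e, rfl⟩ := (Set.Finite.mem_toFinset _).mp he'
  convert hE e using 1
  ext y
  simp only [PartialKGraph.extEdge, Finset.mem_image, Finset.mem_disjSum, Finset.mem_map,
    Finset.mem_univ, true_and]
  constructor
  · rintro ⟨_, ⟨x, hx, rfl⟩ | ⟨_, ⟨b, rfl⟩, rfl⟩, rfl⟩
    · exact hsub e x hx
    · exact (Finset.mem_sdiff.1 (ρ e b).2).1
  · intro hy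
    by_cases hy' : y ∈ e.1.image φ
    · obtain ⟨x, hx, rfl⟩ := Finset.mem_image.1 hy'
      exact ⟨_, Or.inl ⟨x, hx, rfl⟩, rfl⟩
    · refine ⟨_, Or.inr ⟨_, ⟨(ρ e).symm ⟨y, Finset.mem_sdiff.2 ⟨hy, hy'⟩⟩, rfl⟩, rfl⟩, ?_⟩
      simp [Function.Embedding.sigmaMk]

/-- The state just after `m` is tested, with `m` put in front. It is recorded by vertex names rather
than values, so that repetition-freeness of the values later gives injectivity on names. -/
theorem ChainGood.exists_list {V : Type*} {p : List V → ℝ} {B : ℕ → Prop} {w : ℕ → V} {q : ℕ}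
    {v : Fin q → V} (n : ℕ) (U : List (Fin q ⊕ ℕ))
    (h : ChainGood p B w n (U.map (Sum.elim v w))) (m : ℕ) (hm : 1 ≤ m) (hmn : m ≤ n) :
    ∃ L : List (Fin q ⊕ ℕ), Sum.inr m ∈ L ∧ (∀ y ∈ U, y ∈ L) ∧
      (∀ l, m < l → l ≤ n → B l → Sum.inr l ∈ L) ∧ 0 < p (L.map (Sum.elim v w)) := by
  classical
  induction n generalizing U with
  | zero => omega
  | succ n ih =>
    obtain ⟨h1, h2⟩ := h
    rcases hmn.eq_or_lt with rfl | hlt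
    · exact ⟨Sum.inr (n + 1) :: U, by simp, fun y hy => List.mem_cons_of_mem _ hy,
        fun l h3 h4 => absurd h3 (by omega), by simpa using h1⟩
    · by_cases hB : B (n + 1)
      · rw [if_pos hB] at h2
        obtain ⟨L, hL1, hL2, hL3, hL4⟩ := ih (Sum.inr (n + 1) :: U) (by simpa using h2) (by omega)
        refine ⟨L, hL1, fun y hy => hL2 y (List.mem_cons_of_mem _ hy), fun l h3 h4 h5 => ?_, hL4⟩
        rcases h4.eq_or_lt with rfl | h4
        · exact hL2 _ (by simp)
        · exact hL3 l h3 (by omega) h5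
      · rw [if_neg hB] at h2
        obtain ⟨L, hL1, hL2, hL3, hL4⟩ := ih U h2 (by omega)
        refine ⟨L, hL1, hL2, fun l h3 h4 h5 => ?_, hL4⟩
        rcases h4.eq_or_lt with rfl | h4
        · exact absurd h5 hB
        · exact hL3 l h3 (by omega) h5

/-- Points that are good for several threshold vectors give homomorphisms from the extension of
the union of the corresponding partial forests. -/
theorem exists_isHom_of_chainGood {k i N : ℕ} (hi : i < k) {V : Type*} [DecidableEq V]
    (G : KGraph k V) (T : Finset (ForestIndex i N)) (v : Fin (k - i - 1) → V) (w : ℕ → V)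
    (h : ∀ τ ∈ T, ChainGood G.edgeLaw τ.IsThreshold w N (List.ofFn v)) :
    ∃ f, KGraph.IsHom (PartialKGraph.union T fun τ => τ.forest hi).extension G f := by
  refine PartialKGraph.exists_isHom_extension _ G (Sum.elim v fun m => w m) ?_
  rintro e ⟨τ, hτ, -, s, ⟨j, m, hm1, hm2, rfl⟩, hes⟩
  have hm := Finset.mem_Icc.1 m.2
  have hgood := h τ hτ
  have hU : List.ofFn v = (List.ofFn fun a => (Sum.inl a : Fin (k - i - 1) ⊕ ℕ)).map
      (Sum.elim v w) := by
    rw [List.map_ofFn]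
    rfl
  rw [hU] at hgood
  obtain ⟨L, hL1, hL2, hL3, hL4⟩ := hgood.exists_list N _ m hm.1 hm.2
  obtain ⟨hnodup, E, hE, hLE⟩ := KGraph.edgeLaw_pos hL4
  let ι : ForestVertex k i N → Fin (k - i - 1) ⊕ ℕ := Sum.map id fun m => m
  have hι : Function.Injective ι := Function.injective_id.sumMap Subtype.val_injective
  have hφ : ∀ x, (Sum.elim v fun m : Finset.Icc 1 N => w m) x = Sum.elim v w (ι x) := by
    rintro (x | x) <;> rfl
  have hmem : ∀ x ∈ e, ι x ∈ L := by
    intro x hx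
    have hx := hes hx
    rw [ForestIndex.spanningEdge, Finset.mem_disjSum] at hx
    rcases hx with ⟨a, -, rfl⟩ | ⟨b, hb, rfl⟩
    · exact hL2 _ (by simp [ι])
    · rw [Finset.mem_union, Finset.mem_singleton, Finset.mem_filter] at hb
      rcases hb with rfl | ⟨-, l, hjl, hl, hlb⟩
      · exact hL1
      · refine hL3 b ?_ (Finset.mem_Icc.1 b.2).2 ⟨l, (Fin.zero_le _).trans_lt hjl, hl, hlb⟩
        rw [← hlb]
        exact hm2.trans_le (τ.strictMono.monotone (Fin.castSucc_lt_iff_succ_le.1 hjl))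
  refine ⟨fun x hx y hy hxy => ?_, E, hE, fun x hx => ?_⟩
  · rw [hφ, hφ] at hxy
    exact hι (List.inj_on_of_nodup_map hnodup (hmem x hx) (hmem y hy) hxy)
  · rw [hφ]
    exact hLE _ (List.mem_map_of_mem (hmem x hx))

/-! ### The complete `k`-graph and the main theorem -/

/-- Uniform weights 1/r. They are in fact optimal, but only this lower bound for the supremum is
needed. -/
theorem prod_range_le_blowupDensity_complete (k r : ℕ) (hk : 1 ≤ k) (hkr : k ≤ r) :
    ∏ j ∈ Finset.range k, ((((r - k : ℕ) : ℝ) + j + 1) / ((r - k : ℕ) + k)) ≤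
      (KGraph.complete k r).blowupDensity := by
  have hr : (0 : ℝ) < r := by exact_mod_cast (by omega : 0 < r)
  have h1 : (∏ j ∈ Finset.range k, ((((r - k : ℕ) : ℝ) + j + 1) / ((r - k : ℕ) + k))) =
      k.factorial * (r.choose k * (1 / r) ^ k) := by
    have h2 : ((r - k : ℕ) : ℝ) + k = r := by exact_mod_cast Nat.sub_add_cancel hkr
    have h3 : ∏ j ∈ Finset.range k, (((r - k : ℕ) : ℝ) + j + 1) =
        ((r - k + 1).ascFactorial k : ℝ) := by
      rw [Nat.ascFactorial_eq_prod_range]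
      push_cast
      exact Finset.prod_congr rfl fun j _ => by ring
    rw [h2, Finset.prod_div_distrib, h3, Nat.ascFactorial_eq_factorial_mul_choose,
      Nat.sub_add_cancel hkr]
    simp
    field_simp
  rw [h1, KGraph.blowupDensity]
  refine mul_le_mul_of_nonneg_left ?_ (Nat.cast_nonneg _)
  refine le_csSup ⟨(KGraph.complete k r).edges.card, ?_⟩ ⟨fun _ => 1 / r, ⟨fun _ => ?_, ?_⟩, ?_⟩
  · rintro _ ⟨x, hx, rfl⟩
    refine (Finset.sum_le_card_nsmul _ _ 1 fun e _ => ?_).trans (by simp)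
    exact Finset.prod_le_one (fun i _ => hx.1 i) fun i _ =>
      hx.2 ▸ Finset.single_le_sum (fun j _ => hx.1 j) (Finset.mem_univ i)
  · positivity
  · simp [hr.ne']
  · simp only [Finset.prod_const]
    rw [Finset.sum_congr rfl fun e he => by rw [(KGraph.complete k r).card_eq e he]]
    simp [KGraph.complete]

/-- The entropy bound applied to the random ordered edge. If too many threshold vectors were good at
one point, a subset `T'` of the prescribed size would give a homomorphism from a member of `𝓕`
through an extension into `G`. -/
theorem KGraph.factorial_mul_card_edges_le (k r : ℕ) (hk : 1 ≤ k) (𝓕 : Set (FinKGraph.{u} k))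
    (h𝓕 : ∀ i : ℕ, 1 ≤ i → ∀ hi : i < k, ∀ N : ℕ, ∀ T : Finset (ForestIndex i N),
      T.card = (r - k + i).choose i + 1 →
      ¬ KGraph.IsHomFree 𝓕 (PartialKGraph.union T fun τ => τ.forest hi).extension)
    {V : Type*} [Fintype V] (G : KGraph k V) (hG : G.IsHomFree 𝓕) :
    (k.factorial : ℝ) * G.edges.card ≤ (Fintype.card V : ℝ) ^ k *
      ∏ j ∈ Finset.range k, ((((r - k : ℕ) : ℝ) + j + 1) / ((r - k : ℕ) + k)) := by
  classical
  have hfac : ∀ j ∈ Finset.range k,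
      0 < (((r - k : ℕ) : ℝ) + j + 1) / ((r - k : ℕ) + k) := fun j _ => by positivity
  rcases G.edges.eq_empty_or_nonempty with hE | hE
  · rw [hE, Finset.card_empty, Nat.cast_zero, mul_zero]
    exact mul_nonneg (by positivity) (Finset.prod_nonneg fun j hj => (hfac j hj).le)
  have hp := G.edgeLaw_isExchangeable hE
  have hV : (0 : ℝ) < Fintype.card V := by
    obtain ⟨e, he⟩ := hE
    have : e.Nonempty := Finset.card_pos.1 (by rw [G.card_eq e he]; omega)
    have : Nonempty V := ⟨this.choose⟩
    exact_mod_cast Fintype.card_pos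
  have hEc : (0 : ℝ) < G.edges.card := by exact_mod_cast hE.card_pos
  have hkf : (0 : ℝ) < k.factorial := by exact_mod_cast k.factorial_pos
  have h1 := hp.tupleEntropy_le (r - k) hk fun i hi1 hi N T v w => by
    by_contra! hcon
    obtain ⟨T', hT', hcard⟩ := Finset.exists_subset_card_eq (Nat.succ_le_of_lt hcon)
    have h2 := h𝓕 i hi1 hi N T' hcard
    simp only [KGraph.IsHomFree, not_forall, not_not] at h2
    obtain ⟨F, hF, f, hf⟩ := h2
    obtain ⟨g, hg⟩ := exists_isHom_of_chainGood hi G T' v w fun τ hτ =>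
      (Finset.mem_filter.1 (hT' hτ)).2
    exact hG F hF ⟨g ∘ f, hg.comp hf⟩
  have h2 := G.log_le_tupleEntropy_edgeLaw hE
  have h3 := hp.tupleEntropy_one_le hk
  have h4 : (k : ℝ) * tupleEntropy G.edgeLaw 1 ≤ k * Real.log (Fintype.card V) :=
    mul_le_mul_of_nonneg_left h3 (Nat.cast_nonneg _)
  rw [← Real.log_le_log_iff (by positivity)
    (mul_pos (by positivity) (Finset.prod_pos hfac)), Real.log_mul (by positivity)
    (Finset.prod_pos hfac).ne', Real.log_pow, Real.log_prod fun j hj => (hfac j hj).ne']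
  linarith

theorem theorem8p1 (k r : ℕ) (hk : 1 ≤ k) (hkr : k ≤ r)
    (𝓕 : Set (FinKGraph.{u} k))
    (h𝓕 : ∀ i : ℕ, 1 ≤ i → ∀ hi : i < k, ∀ N : ℕ, ∀ T : Finset (ForestIndex i N),
      T.card = (r - k + i).choose i + 1 →
      ¬ KGraph.IsHomFree 𝓕
        (PartialKGraph.union T fun τ => τ.forest hi).extension) :
    Tendsto (KGraph.turanRatio 𝓕) atTop (𝓝 (KGraph.turanDensity 𝓕)) ∧
      KGraph.turanDensity 𝓕 ≤ (KGraph.complete k r).blowupDensity := by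
  refine ⟨KGraph.tendsto_turanRatio 𝓕, ?_⟩
  refine le_trans ?_ (prod_range_le_blowupDensity_complete k r hk hkr)
  set c : ℝ := ∏ j ∈ Finset.range k, ((((r - k : ℕ) : ℝ) + j + 1) / ((r - k : ℕ) + k)) with hc
  have hc0 : 0 ≤ c := Finset.prod_nonneg fun j _ => by positivity
  set π := KGraph.turanDensity 𝓕
  by_contra! hcon
  -- With ε = (π - c)/2, hom-free graphs on `s` vertices force π - ε ≤ c as s → ∞, although π - ε is
  -- the midpoint of `c` and `π`. The requirement ε < π holds because c ≥ 0.
  have h1 : Tendsto (fun s : ℕ => (π - (π - c) / 2) * ((s.descFactorial k : ℝ) / (s : ℝ) ^ k))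
      atTop (𝓝 ((π - (π - c) / 2) * 1)) := (tendsto_descFactorial_div_pow k).const_mul _
  have h2 : (π - (π - c) / 2) * 1 ≤ c := by
    refine le_of_tendsto h1 ?_
    filter_upwards [eventually_ge_atTop k, eventually_gt_atTop 0] with s hs hs0
    have hs0' : (0 : ℝ) < s := by exact_mod_cast hs0
    obtain ⟨G, hG, hcard⟩ := KGraph.exists_isHomFree 𝓕 s hs ((π - c) / 2) (by linarith)
      (by linarith)
    have h3 := KGraph.factorial_mul_card_edges_le k r hk 𝓕 h𝓕 G hG
    rw [Fintype.card_fin] at h3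
    rw [mul_div_assoc', div_le_iff₀ (by positivity), Nat.descFactorial_eq_factorial_mul_choose]
    push_cast
    have h4 := mul_le_mul_of_nonneg_left hcard (Nat.cast_nonneg (α := ℝ) k.factorial)
    linarith
  linarith
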